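/- Lemma 2.11. Let $r>0$ and $\lambda>0$. There is a constant $c_2>0$, depending only on $r$ and $\lambda$, such that the following holds. Let $S$ be a homogeneous Poisson process with parameter $\lambda$ on $\mathbb R^2$, regarded as a random subset of $\mathbb R^2$. For $x=(x_1,x_2)\in\mathbb R^2$ and $t\ge x_2$ let $$M(x,t,r)=\{(x_1',x_2'):|x_1'-x_1|\le r,\ x_2\le x_2'\le t\},$$ let $\tau(x)=\inf\{t>x_2: M(x,t,r)\cap(S\setminus\{x\})\ne\emptyset\}$, and let $\alpha(x)$ be the (almost surely unique) point of $M(x,\tau(x),r)\cap(S\setminus\{x\})$. Put $\alpha^0(x)=x$ and $\alpha^{n}(x)=\alpha(\alpha^{n-1}(x))$ for $n\ge1$, let $\tau^n(x)$ be the second coordinate of $\alpha^n(x)$, and for $t\ge x_2$ define the walk $\xi^x(t)$ as the first coordinate of $\alpha^n(x)$, where $n\ge 0$ is such that $\tau^n(x)\le t<\tau^{n+1}(x)$. Let $$\mathcal T=\inf\{t>0:\ \xi^{(0,0)}(t)=\xi^{(2r,0)}(t)\},\qquad \inf\emptyset=+\infty,$$ be the coalescence time of the walks started at $(0,0)$ and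 $(2r,0)$. Then $$\mathbb P(\mathcal T>t)\le \frac{c_2}{\sqrt t}\qquad\text{for all } t>0 .$$ -/

import Mathlib

open MeasureTheory ProbabilityTheory Set

noncomputable section

namespace PoissonTree

/-- The random set `S : Ω → Set (ℝ × ℝ)` is a homogeneous Poisson process on the plane with
parameter `lam` under `P`: counts of points in Borel sets are random variables, the count in a
Borel set `B` of finite area is Poisson distributed with mean `lam * area B`, and the counts in
finitely many pairwise disjoint Borel sets are independent. -/
structure IsPoissonProcess {Ω : Type*} [MeasurableSpace Ω] (P : Measure Ω) (lam : ℝ)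
    (S : Ω → Set (ℝ × ℝ)) : Prop where
  measurable_count : ∀ B : Set (ℝ × ℝ), MeasurableSet B →
    Measurable (fun ω => (S ω ∩ B).encard)
  law_count : ∀ B : Set (ℝ × ℝ), MeasurableSet B → volume B < ⊤ →
    P.map (fun ω => (S ω ∩ B).encard) =
      (poissonMeasure (lam * volume.real B).toNNReal).map (Nat.cast : ℕ → ℕ∞)
  indep_count : ∀ (n : ℕ) (B : Fin n → Set (ℝ × ℝ)), (∀ i, MeasurableSet (B i)) →
    Pairwise (fun i j => Disjoint (B i) (B j)) →
    iIndepFun (fun i ω => (S ω ∩ B i).encard) P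

/-- The rectangle `M(x, t, r)` of half-width `r` from height `x₂` up to height `t`. -/
def rect (x : ℝ × ℝ) (t r : ℝ) : Set (ℝ × ℝ) :=
  {y | |y.1 - x.1| ≤ r ∧ x.2 ≤ y.2 ∧ y.2 ≤ t}

/-- The first height at which the growing rectangle meets a point of `S` other than `x`. -/
def hitHeight (x : ℝ × ℝ) (S : Set (ℝ × ℝ)) (r : ℝ) : ℝ :=
  sInf {t | x.2 < t ∧ (rect x t r ∩ (S \ {x})).Nonempty}

open Classical in
/-- The point `α(x)`: the unique point of `S \ {x}` in the rectangle stopped at the first hitting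
height. Where there is no such unique point (an event of probability zero for a
Poisson process), the value is `x` by convention. -/
def mother (S : Set (ℝ × ℝ)) (r : ℝ) (x : ℝ × ℝ) : ℝ × ℝ :=
  if h : ∃! s, s ∈ rect x (hitHeight x S r) r ∩ (S \ {x}) then h.choose else x

/-- `αⁿ(x)`, with `α⁰(x) = x`. -/
def ancestor (S : Set (ℝ × ℝ)) (r : ℝ) (x : ℝ × ℝ) (n : ℕ) : ℝ × ℝ :=
  (mother S r)^[n] x

/-- The walk `ξˣ(t)`: the first coordinate of `αⁿ(x)`, where `n` is the index with
`τⁿ(x) ≤ t < τⁿ⁺¹(x)`, and `τⁿ(x)` is the second coordinate of `αⁿ(x)`. (As `τⁿ(x)` is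
nondecreasing in `n`, there is at most one such index; if there is none, the value is `x₁`.) -/
def walk (S : Set (ℝ × ℝ)) (r : ℝ) (x : ℝ × ℝ) (t : ℝ) : ℝ :=
  (ancestor S r x (sInf {n : ℕ | (ancestor S r x n).2 ≤ t ∧ t < (ancestor S r x (n + 1)).2})).1

/-- The difference `Δ_γ(t)` of the walks started at `(0, 0)` and `(γ, 0)`. -/
def difference (S : Set (ℝ × ℝ)) (r γ t : ℝ) : ℝ :=
  walk S r (γ, 0) t - walk S r (0, 0) t

/-- The coalescence time `inf {t > 0 : Δ_{2r}(t) = 0}` of the walks started at `(0, 0)` and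
`(2r, 0)`, with value `⊤` if they never meet. -/
def coalescenceTime (S : Set (ℝ × ℝ)) (r : ℝ) : EReal :=
  ⨅ t ∈ {t : ℝ | 0 < t ∧ difference S r (2 * r) t = 0}, (t : EReal)

end PoissonTree

end

/-! The difference of the two walks is a nonnegative martingale whose variance grows at least at a
constant rate until they meet. Stop it when it reaches a level of order √t. By Markov's inequality
it gets that high with probability O(1/√t). Its second moment is at most O(√t) times its constant
mean, so it is still running at time t with probability O(√t / t).

The argument is carried out on a grid of cells of width ε = r/m and height δ = t/n, whose counts are
independent. A chain of two columns is driven by the rows and moves only when a row has exactly one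
point in the columns near the walkers. All these columns are equally likely to be hit, so the gap of
the chain is an exact martingale (`IsCellField.integral_gap`). While the chain runs, the second
moment of the gap grows at a definite rate (`IsCellField.integral_gap_sq_succ`). Together these give
`IsCellField.prob_gap_ne_zero_le`.

The chain tracks the true walks as long as it runs and all rows are good (`isCoupled_chain`). A row
is bad if it has several points near the walkers, or a point in a column at distance exactly m from
a walker, where the column does not decide whether the point is within r. With t fixed and n a
multiple of m, some bad row occurs with probability O(1/m), while the main term does not depend on
m. Letting m → ∞ gives `IsPoissonProcess.prob_coalescenceTime_le`. -/

noncomputable section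

namespace PoissonTree

section

/-! ### A discrete pair of coalescing walks -/

/-- The columns which matter for a pair of walkers in the columns `z.1` and `z.2`. -/
def zone (m : ℕ) (z : ℤ × ℤ) : Finset ℤ :=
  Finset.Icc (z.1 - 2 * m) (z.1 + 2 * m) ∪ Finset.Icc (z.2 - 2 * m) (z.2 + 2 * m)

/-- Among the columns in `U`, the row `w` has exactly one point, and it lies in column `c`. -/
def IsHit (U : Finset ℤ) (w : ℤ → ℕ∞) (c : ℤ) : Prop :=
  w c = 1 ∧ ∀ a ∈ U, a ≠ c → w a = 0

/-- A walker in column `a` jumps to a point in column `c` if it is within distance `m`. -/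
def jump (m : ℕ) (c a : ℤ) : ℤ := if |c - a| ≤ m then c else a

/-- Both walkers see a point in column `c`. -/
def move (m : ℕ) (c : ℤ) (z : ℤ × ℤ) : ℤ × ℤ := (jump m c z.1, jump m c z.2)

/-- The distance of the two walkers. -/
def gap (z : ℤ × ℤ) : ℤ := z.2 - z.1

open Classical in
/-- One step of the pair of walkers, which is stopped when the gap reaches `K`. -/
def step (m : ℕ) (K : ℤ) (z : ℤ × ℤ) (w : ℤ → ℕ∞) : ℤ × ℤ :=
  if K ≤ gap z then z
  else if h : ∃ c ∈ zone m z, IsHit (zone m z) w c then move m h.choose z else z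

/-- The pair of walkers started at distance `2 * m` and driven by the rows `w k`. -/
def chain (m : ℕ) (K : ℤ) (w : ℕ → ℤ → ℕ∞) : ℕ → ℤ × ℤ
  | 0 => (0, 2 * m)
  | k + 1 => step m K (chain m K w k) (w k)

lemma IsHit.unique {U : Finset ℤ} {w : ℤ → ℕ∞} {c c' : ℤ} (h : IsHit U w c) (h' : IsHit U w c')
    (hc : c ∈ U) : c = c' := by
  by_contra hne
  have := h'.2 c hc hne
  rw [h.1] at this
  exact one_ne_zero this

lemma step_of_le {m : ℕ} {K : ℤ} {z : ℤ × ℤ} (h : K ≤ gap z) (w : ℤ → ℕ∞) :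
    step m K z w = z := if_pos h

lemma step_of_hit {m : ℕ} {K : ℤ} {z : ℤ × ℤ} {w : ℤ → ℕ∞} {c : ℤ} (h : gap z < K)
    (hc : c ∈ zone m z) (hit : IsHit (zone m z) w c) : step m K z w = move m c z := by
  have hex : ∃ c ∈ zone m z, IsHit (zone m z) w c := ⟨c, hc, hit⟩
  rw [step, if_neg (not_le.2 h), dif_pos hex,
    hex.choose_spec.2.unique hit hex.choose_spec.1]

lemma step_of_not_hit {m : ℕ} {K : ℤ} {z : ℤ × ℤ} {w : ℤ → ℕ∞}
    (h : ∀ c ∈ zone m z, ¬ IsHit (zone m z) w c) : step m K z w = z := by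
  rw [step]
  split_ifs with h1 h2
  · rfl
  · obtain ⟨c, hc, hit⟩ := h2
    exact absurd hit (h c hc)
  · rfl

-- Hits in different columns exclude each other, so at most one summand is nonzero. In this form,
-- averaging over the row only needs the probability of each hit.
open Classical in
lemma apply_step {m : ℕ} {K : ℤ} {z : ℤ × ℤ} (h : gap z < K) (w : ℤ → ℕ∞) (f : ℤ × ℤ → ℝ) :
    f (step m K z w) =
      f z + ∑ c ∈ zone m z, if IsHit (zone m z) w c then f (move m c z) - f z else 0 := by
  by_cases hex : ∃ c ∈ zone m z, IsHit (zone m z) w c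
  · obtain ⟨c, hc, hit⟩ := hex
    rw [step_of_hit h hc hit, Finset.sum_eq_single c]
    · simp [hit]
    · intro b hb hbc
      rw [if_neg]
      exact fun hb' => hbc (hb'.unique hit hb)
    · exact fun hn => absurd hc hn
  · push Not at hex
    rw [step_of_not_hit hex, Finset.sum_eq_zero, add_zero]
    exact fun c hc => if_neg (hex c hc)

/-- The values of the gap which the stopped walk can take. -/
def Reachable (m : ℕ) (K : ℤ) (z : ℤ × ℤ) : Prop :=
  gap z = 0 ∨ (m ≤ gap z ∧ gap z ≤ K + m)

lemma gap_move_of_gap_eq_zero {m : ℕ} {c : ℤ} {z : ℤ × ℤ} (h : gap z = 0) :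
    gap (move m c z) = 0 := by
  have h' : z.2 = z.1 := by simpa [gap, sub_eq_zero] using h
  simp [gap, move, h']

lemma step_cases (m : ℕ) (K : ℤ) (z : ℤ × ℤ) (w : ℤ → ℕ∞) :
    step m K z w = z ∨ (gap z < K ∧ ∃ c, step m K z w = move m c z) := by
  rw [step]
  split_ifs with h1 h2
  · exact Or.inl rfl
  · exact Or.inr ⟨not_le.1 h1, _, rfl⟩
  · exact Or.inl rfl

/-- A point seen by both walkers merges them. A point seen by one alone is more than `m` columns
from the other, on the side that preserves the order. One jump adds at most `m` to a gap below `K`.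
-/
lemma Reachable.step {m : ℕ} {K : ℤ} {z : ℤ × ℤ} (h : Reachable m K z) (w : ℤ → ℕ∞) :
    Reachable m K (step m K z w) := by
  rcases step_cases m K z w with h' | ⟨hK, c, h'⟩
  · rwa [h']
  · rw [h']
    rcases h with h | h
    · exact Or.inl (gap_move_of_gap_eq_zero h)
    · unfold Reachable move jump gap at *
      simp only [abs_le]
      split_ifs <;> omega

lemma gap_step_of_gap_eq_zero {m : ℕ} {K : ℤ} {z : ℤ × ℤ} (h : gap z = 0) (w : ℤ → ℕ∞) :
    gap (step m K z w) = 0 := by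
  rcases step_cases m K z w with h' | ⟨-, c, h'⟩
  · rwa [h']
  · rw [h']; exact gap_move_of_gap_eq_zero h

lemma reachable_chain {m : ℕ} {K : ℤ} (hK : (m : ℤ) ≤ K) (w : ℕ → ℤ → ℕ∞) (k : ℕ) :
    Reachable m K (chain m K w k) := by
  induction k with
  | zero => right; simp only [chain, gap]; omega
  | succ k ih => exact ih.step _

/-- The window is symmetric about `a` and columns outside it cause no jump, so the displacements
cancel. This is the source of the martingale property. -/
lemma sum_jump_sub {m : ℕ} {a : ℤ} {U : Finset ℤ} (hU : Finset.Icc (a - m) (a + m) ⊆ U) :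
    ∑ c ∈ U, (jump m c a - a) = 0 := by
  have h1 : ∑ c ∈ U, (jump m c a - a) = ∑ c ∈ Finset.Icc (a - m) (a + m), (c - a) := by
    rw [← Finset.sum_subset hU]
    · refine Finset.sum_congr rfl fun c hc => ?_
      rw [Finset.mem_Icc] at hc
      rw [jump, if_pos (abs_le.2 (by omega))]
    · intro c _ hc
      rw [jump, if_neg, sub_self]
      rw [abs_le]
      rw [Finset.mem_Icc] at hc
      omega
  have h2 : ∑ c ∈ Finset.Icc (a - m) (a + m), (c - a)
      = ∑ c ∈ Finset.Icc (a - m) (a + m), (-(c - a)) := by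
    refine Finset.sum_nbij' (fun c => 2 * a - c) (fun c => 2 * a - c) ?_ ?_ ?_ ?_ ?_ <;>
      intro c hc <;> simp only [Finset.mem_Icc] at * <;> omega
  rw [Finset.sum_neg_distrib] at h2
  rw [h1]; omega

lemma Icc_left_subset_zone (m : ℕ) (z : ℤ × ℤ) :
    Finset.Icc (z.1 - m) (z.1 + m) ⊆ zone m z := by
  intro c hc
  simp only [zone, Finset.mem_union, Finset.mem_Icc] at *
  omega

lemma Icc_right_subset_zone (m : ℕ) (z : ℤ × ℤ) :
    Finset.Icc (z.2 - m) (z.2 + m) ⊆ zone m z := by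
  intro c hc
  simp only [zone, Finset.mem_union, Finset.mem_Icc] at *
  omega

lemma sum_gap_move_sub (m : ℕ) (z : ℤ × ℤ) :
    ∑ c ∈ zone m z, (gap (move m c z) - gap z) = 0 := by
  have h : ∀ c, gap (move m c z) - gap z = (jump m c z.2 - z.2) - (jump m c z.1 - z.1) := by
    intro c; simp only [gap, move]; ring
  simp_rw [h, Finset.sum_sub_distrib (fun c => jump m c z.2 - z.2)]
  rw [sum_jump_sub (Icc_left_subset_zone m z), sum_jump_sub (Icc_right_subset_zone m z), sub_zero]

lemma cube_le_sum_sq (m : ℕ) : (m : ℤ) ^ 3 ≤ 3 * ∑ k ∈ Finset.range m, ((k : ℤ) + 1) ^ 2 := by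
  induction m with
  | zero => simp
  | succ m ih =>
    rw [Finset.sum_range_succ]
    push_cast
    nlinarith [Int.natCast_nonneg m]

lemma sum_gap_sq_move_sub (m : ℕ) (z : ℤ × ℤ) :
    ∑ c ∈ zone m z, (gap (move m c z) ^ 2 - gap z ^ 2)
      = ∑ c ∈ zone m z, (gap (move m c z) - gap z) ^ 2 := by
  have h : ∀ c, gap (move m c z) ^ 2 - gap z ^ 2
      = (gap (move m c z) - gap z) ^ 2 + 2 * gap z * (gap (move m c z) - gap z) := by
    intro c; ring
  simp_rw [h, Finset.sum_add_distrib, ← Finset.mul_sum]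
  rw [sum_gap_move_sub, mul_zero, add_zero]

/-- The `m` columns just left of the left walker are in its window but, as the gap is at least `m`,
not in that of the right walker. Points there widen the gap by 1, ..., `m`, and the squares of these
sum to at least `m ^ 3 / 3`. -/
lemma cube_le_sum_gap_sq {m : ℕ} {z : ℤ × ℤ} (hz : m ≤ gap z) :
    (m : ℤ) ^ 3 ≤ 3 * ∑ c ∈ zone m z, (gap (move m c z) ^ 2 - gap z ^ 2) := by
  rw [sum_gap_sq_move_sub]
  refine (cube_le_sum_sq m).trans ?_
  have hinj : Set.InjOn (fun k : ℕ => z.1 - 1 - k) (Finset.range m) := by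
    intro a _ b _ hab
    simp only at hab
    omega
  have hsub : (Finset.range m).image (fun k : ℕ => z.1 - 1 - (k : ℤ)) ⊆ zone m z := by
    intro c hc
    simp only [Finset.mem_image, Finset.mem_range] at hc
    obtain ⟨k, hk, rfl⟩ := hc
    simp only [zone, Finset.mem_union, Finset.mem_Icc]
    omega
  have := Finset.sum_le_sum_of_subset_of_nonneg hsub
    (f := fun c => (gap (move m c z) - gap z) ^ 2) (fun _ _ _ => sq_nonneg _)
  rw [Finset.sum_image hinj] at this
  refine (mul_le_mul_of_nonneg_left (le_trans (le_of_eq ?_) this) (by norm_num))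
  refine Finset.sum_congr rfl fun k hk => ?_
  rw [Finset.mem_range] at hk
  simp only [gap, move, jump] at *
  rw [if_neg (by rw [abs_le]; omega), if_pos (by rw [abs_le]; omega)]
  ring

lemma card_zone_le (m : ℕ) (hm : 1 ≤ m) (z : ℤ × ℤ) : (zone m z).card ≤ 10 * m := by
  refine (Finset.card_union_le _ _).trans ?_
  simp only [Int.card_Icc]
  omega

end

section

/-! ### Independent cell counts -/

/-- A field of independent random counts which take the values `0` and `1` with the probabilities
of the Poisson distribution with mean `μ`. -/
structure IsCellField {Ω : Type*} [MeasurableSpace Ω] (P : Measure Ω) (μ : ℝ)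
    (N : ℤ × ℕ → Ω → ℕ∞) : Prop where
  measurable : ∀ p, Measurable (N p)
  indep : iIndepFun N P
  zero : ∀ p, P.real (N p ⁻¹' {0}) = Real.exp (-μ)
  one : ∀ p, P.real (N p ⁻¹' {1}) = μ * Real.exp (-μ)

/-- The row with index `k` of a field of counts. -/
def row {Ω : Type*} (N : ℤ × ℕ → Ω → ℕ∞) (k : ℕ) (ω : Ω) : ℤ → ℕ∞ := fun a => N (a, k) ω

/-- The state at time `k` of the chain driven by the rows of a field of counts. -/
def fieldChain {Ω : Type*} (N : ℤ × ℕ → Ω → ℕ∞) (m : ℕ) (K : ℤ) (k : ℕ) (ω : Ω) : ℤ × ℤ :=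
  chain m K (fun l => row N l ω) k

/-- A row which has either no point in the zone, or just one which is not near the boundary of the
window of a walker. -/
def GoodRow (m : ℕ) (z : ℤ × ℤ) (w : ℤ → ℕ∞) : Prop :=
  (∀ a ∈ zone m z, w a = 0) ∨
    ∃ c ∈ zone m z, |c - z.1| ≠ m ∧ |c - z.2| ≠ m ∧ IsHit (zone m z) w c

lemma measurableSet_isHit (U : Finset ℤ) (c : ℤ) : MeasurableSet {w : ℤ → ℕ∞ | IsHit U w c} := by
  have h : {w : ℤ → ℕ∞ | IsHit U w c} =
      (fun w => w c) ⁻¹' {1} ∩ ⋂ a ∈ U, ⋂ _ : a ≠ c, (fun w => w a) ⁻¹' {0} := by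
    ext w; simp [IsHit]
  rw [h]
  refine (measurable_pi_apply c (measurableSet_singleton _)).inter ?_
  exact Finset.measurableSet_biInter _ fun a _ => MeasurableSet.iInter fun _ =>
    measurable_pi_apply a (measurableSet_singleton _)

lemma measurableSet_empty_row (U : Finset ℤ) :
    MeasurableSet {w : ℤ → ℕ∞ | ∀ a ∈ U, w a = 0} := by
  have h : {w : ℤ → ℕ∞ | ∀ a ∈ U, w a = 0} = ⋂ a ∈ U, (fun w => w a) ⁻¹' {0} := by
    ext w; simp
  rw [h]
  exact Finset.measurableSet_biInter _ fun a _ => measurable_pi_apply a (measurableSet_singleton _)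

lemma goodRow_eq (m : ℕ) (z : ℤ × ℤ) :
    {w | GoodRow m z w} = {w | ∀ a ∈ zone m z, w a = 0} ∪
      ⋃ c ∈ (zone m z).filter (fun c => |c - z.1| ≠ m ∧ |c - z.2| ≠ m),
        {w | IsHit (zone m z) w c} := by
  ext w
  simp [GoodRow, and_assoc]

lemma measurableSet_goodRow (m : ℕ) (z : ℤ × ℤ) : MeasurableSet {w | GoodRow m z w} := by
  rw [goodRow_eq]
  exact (measurableSet_empty_row _).union
    (Finset.measurableSet_biUnion _ fun c _ => measurableSet_isHit _ c)

open Classical in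
lemma measurable_step (m : ℕ) (K : ℤ) (z : ℤ × ℤ) : Measurable (step m K z) := by
  refine measurable_to_countable' fun y => ?_
  by_cases hK : K ≤ gap z
  · have : step m K z = fun _ => z := funext fun w => step_of_le hK w
    rw [this]
    exact measurable_const (measurableSet_singleton y)
  · rw [not_le] at hK
    have h : step m K z ⁻¹' {y} =
        (⋃ c ∈ (zone m z).filter (fun c => move m c z = y), {w | IsHit (zone m z) w c}) ∪
        (if z = y then (⋃ c ∈ zone m z, {w | IsHit (zone m z) w c})ᶜ else ∅) := by
      ext w
      by_cases hex : ∃ c ∈ zone m z, IsHit (zone m z) w c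
      · obtain ⟨c, hc, hit⟩ := hex
        have h2 : w ∉ (if z = y then (⋃ c ∈ zone m z, {w | IsHit (zone m z) w c})ᶜ else ∅) := by
          split_ifs
          · simp only [mem_compl_iff, not_not]
            exact mem_biUnion hc hit
          · exact notMem_empty w
        rw [mem_union, or_iff_left h2]
        simp only [mem_preimage, mem_singleton_iff, step_of_hit hK hc hit, mem_iUnion,
          Finset.mem_filter, mem_ofPred_eq, exists_prop]
        constructor
        · exact fun h => ⟨c, ⟨hc, h⟩, hit⟩
        · rintro ⟨c', ⟨hc', h⟩, hit'⟩
          rwa [hit.unique hit' hc]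
      · push Not at hex
        simp only [mem_preimage, mem_singleton_iff, step_of_not_hit hex, mem_union, mem_iUnion,
          Finset.mem_filter, mem_ofPred_eq, exists_prop]
        constructor
        · intro h
          right
          simpa [h] using hex
        · rintro (⟨c, ⟨hc, -⟩, hit⟩ | h)
          · exact absurd hit (hex c hc)
          · split_ifs at h with hzy
            · exact hzy
            · exact absurd h (notMem_empty w)
    rw [h]
    refine (Finset.measurableSet_biUnion _ fun c _ => measurableSet_isHit _ c).union ?_
    split_ifs
    · exact (Finset.measurableSet_biUnion _ fun c _ => measurableSet_isHit _ c).compl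
    · exact MeasurableSet.empty

/-- The state at time `k` uses only the rows below `k`, which makes it independent of row `k`. -/
lemma measurable_fieldChain_past {Ω : Type*} (N : ℤ × ℕ → Ω → ℕ∞) (m : ℕ) (K : ℤ) (k : ℕ) :
    Measurable[⨆ p ∈ {p : ℤ × ℕ | p.2 < k}, MeasurableSpace.comap (N p) inferInstance]
      (fieldChain N m K k) := by
  induction k with
  | zero => exact @measurable_const _ _ _ (_) _
  | succ k ih =>
    set F := ⨆ p ∈ {p : ℤ × ℕ | p.2 < k + 1}, MeasurableSpace.comap (N p) inferInstance with hF
    have h1 : Measurable[F] (fieldChain N m K k) :=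
      ih.mono (biSup_mono fun p hp => Nat.lt_succ_of_lt hp) le_rfl
    have h2 : Measurable[F] (row N k) := by
      refine (@measurable_pi_iff _ _ _ F _ _).2 fun a => ?_
      refine Measurable.mono (comap_measurable (N (a, k))) ?_ le_rfl
      exact le_biSup (fun p => MeasurableSpace.comap (N p) inferInstance)
        (show (a, k) ∈ {p : ℤ × ℕ | p.2 < k + 1} from Nat.lt_succ_self k)
    have h3 : Measurable (fun p : (ℤ × ℤ) × (ℤ → ℕ∞) => step m K p.1 p.2) :=
      measurable_from_prod_countable_right fun z => measurable_step m K z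
    have h4 : Measurable[F] (fun ω => (fieldChain N m K k ω, row N k ω)) :=
      @Measurable.prodMk _ F _ _ _ _ _ _ h1 h2
    exact h3.comp h4

variable {Ω : Type*} [mΩ : MeasurableSpace Ω] {P : Measure Ω} {μ : ℝ} {N : ℤ × ℕ → Ω → ℕ∞}

lemma IsCellField.measurable_row (hN : IsCellField P μ N) (k : ℕ) : Measurable (row N k) :=
  measurable_pi_iff.2 fun _ => hN.measurable _

lemma IsCellField.measurable_fieldChain (hN : IsCellField P μ N) (m : ℕ) (K : ℤ) (k : ℕ) :
    Measurable (fieldChain N m K k) :=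
  (measurable_fieldChain_past N m K k).mono
    (iSup₂_le fun p _ => (hN.measurable p).comap_le) le_rfl

lemma IsCellField.indepFun_fieldChain_row (hN : IsCellField P μ N) (m : ℕ) (K : ℤ) (k : ℕ) :
    IndepFun (fieldChain N m K k) (row N k) P := by
  rw [IndepFun_iff_Indep]
  have h := indep_iSup_of_disjoint (fun p => (hN.measurable p).comap_le) hN.indep
    (S := {p : ℤ × ℕ | p.2 < k}) (T := {p : ℤ × ℕ | p.2 = k})
    (Set.disjoint_left.2 fun p (h1 : p.2 < k) (h2 : p.2 = k) => absurd h2 h1.ne)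
  refine indep_of_indep_of_le_left (indep_of_indep_of_le_right h ?_)
    (measurable_fieldChain_past N m K k).comap_le
  refine Measurable.comap_le ?_
  refine (@measurable_pi_iff _ _ _ (_) _ _).2 fun a => ?_
  refine Measurable.mono (comap_measurable (N (a, k))) ?_ le_rfl
  exact le_biSup (fun p => MeasurableSpace.comap (N p) inferInstance)
    (show (a, k) ∈ {p : ℤ × ℕ | p.2 = k} from rfl)

lemma IsCellField.prob_empty (hN : IsCellField P μ N) (k : ℕ) (U : Finset ℤ) :
    P.real {ω | ∀ a ∈ U, row N k ω a = 0} = Real.exp (-(U.card * μ)) := by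
  have hinj : Function.Injective (fun a : ℤ => (a, k)) := fun a b h => (Prod.mk.inj h).1
  have h := (iIndepFun_iff_measure_inter_preimage_eq_mul.1 (hN.indep.precomp hinj)) U
    (sets := fun _ => {0}) (fun _ _ => measurableSet_singleton _)
  have h' : {ω | ∀ a ∈ U, row N k ω a = 0} = ⋂ i ∈ U, N (i, k) ⁻¹' {0} := by
    ext ω; simp [row]
  rw [h', measureReal_def, h, ENNReal.toReal_prod]
  simp_rw [← measureReal_def, hN.zero, Finset.prod_const, ← Real.exp_nat_mul]
  ring_nf

/-- The value does not depend on `c`: given a hit, its column is uniform on `U`. -/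
lemma IsCellField.prob_isHit (hN : IsCellField P μ N) (k : ℕ) {U : Finset ℤ} {c : ℤ}
    (hc : c ∈ U) :
    P.real {ω | IsHit U (row N k ω) c} = μ * Real.exp (-(U.card * μ)) := by
  have hinj : Function.Injective (fun a : ℤ => (a, k)) := fun a b h => (Prod.mk.inj h).1
  have h := (iIndepFun_iff_measure_inter_preimage_eq_mul.1 (hN.indep.precomp hinj)) U
    (sets := fun a => if a = c then {1} else {0}) (fun _ _ => by
      split_ifs <;> exact measurableSet_singleton _)
  have h' : {ω | IsHit U (row N k ω) c} =
      ⋂ i ∈ U, N (i, k) ⁻¹' (if i = c then {1} else {0}) := by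
    ext ω
    simp only [IsHit, row, mem_ofPred_eq, mem_iInter, mem_preimage]
    constructor
    · rintro ⟨h1, h2⟩ i hi
      split_ifs with hic
      · rw [hic]; exact h1
      · exact h2 i hi hic
    · intro H
      refine ⟨by simpa using H c hc, fun a ha hac => by simpa [hac] using H a ha⟩
  rw [h', measureReal_def, h, ENNReal.toReal_prod, ← Finset.mul_prod_erase U _ hc]
  have h2 : ∀ x ∈ U.erase c, (P (N (x, k) ⁻¹' (if x = c then {1} else {0}))).toReal
      = Real.exp (-μ) := by
    intro x hx
    rw [if_neg (Finset.ne_of_mem_erase hx), ← measureReal_def, hN.zero]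
  rw [Finset.prod_congr rfl h2, if_pos rfl, ← measureReal_def, hN.one, Finset.prod_const, mul_assoc,
    ← pow_succ', Finset.card_erase_add_one hc, ← Real.exp_nat_mul]
  ring_nf

variable [IsProbabilityMeasure P]

/-- At most four columns of the zone are at distance exactly `m` from a walker, which costs `4 * μ`;
two or more points among at most `10 * m` columns cost the square. -/
lemma IsCellField.le_prob_goodRow (hN : IsCellField P μ N) (hμ : 0 ≤ μ) {m : ℕ} (hm : 1 ≤ m)
    (k : ℕ) (z : ℤ × ℤ) :
    1 - (4 * μ + (10 * m * μ) ^ 2) ≤ P.real {ω | GoodRow m z (row N k ω)} := by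
  set G := (zone m z).filter (fun c => |c - z.1| ≠ m ∧ |c - z.2| ≠ m) with hG
  have hcard : ((zone m z).card : ℝ) ≤ G.card + 4 := by
    have h1 : zone m z ⊆ G ∪ {z.1 - m, z.1 + m, z.2 - m, z.2 + m} := by
      intro c hc
      simp only [hG, Finset.mem_union, Finset.mem_filter, Finset.mem_insert, Finset.mem_singleton]
      by_cases h : |c - z.1| ≠ m ∧ |c - z.2| ≠ m
      · exact Or.inl ⟨hc, h⟩
      · right
        rw [abs_sub_comm, abs_sub_comm c] at h
        simp only [ne_eq, abs_eq (Int.natCast_nonneg m)] at h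
        omega
    have h2 := (Finset.card_le_card h1).trans (Finset.card_union_le _ _)
    have h3 : ({z.1 - m, z.1 + m, z.2 - m, z.2 + m} : Finset ℤ).card ≤ 4 := Finset.card_le_four
    exact_mod_cast h2.trans (by omega)
  have hu : ((zone m z).card : ℝ) ≤ 10 * m := by exact_mod_cast card_zone_le m hm z
  have hset : {ω | GoodRow m z (row N k ω)} = {ω | ∀ a ∈ zone m z, row N k ω a = 0} ∪
      ⋃ c ∈ G, {ω | IsHit (zone m z) (row N k ω) c} := by
    ext ω
    have := Set.ext_iff.1 (goodRow_eq m z) (row N k ω)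
    simp only [mem_ofPred_eq, mem_union, mem_iUnion] at this ⊢
    exact this
  have hmeas : ∀ c ∈ G, MeasurableSet {ω | IsHit (zone m z) (row N k ω) c} := fun c _ =>
    hN.measurable_row k (measurableSet_isHit _ c)
  have hGz : ∀ c ∈ G, c ∈ zone m z := fun c hc => (Finset.mem_filter.1 hc).1
  have hdisj : Set.PairwiseDisjoint (G : Set ℤ)
      (fun c => {ω | IsHit (zone m z) (row N k ω) c}) := by
    intro c hc c' hc' hne
    refine Set.disjoint_left.2 fun ω h1 h2 => hne ?_
    exact IsHit.unique h1 h2 (hGz c hc)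
  rw [hset, measureReal_union _ (Finset.measurableSet_biUnion _ hmeas) (measure_ne_top _ _)
    (measure_ne_top _ _)]
  · rw [measureReal_biUnion_finset hdisj hmeas, hN.prob_empty,
      Finset.sum_congr rfl fun c hc => hN.prob_isHit k (hGz c hc), Finset.sum_const, nsmul_eq_mul]
    set u : ℝ := ((zone m z).card : ℝ)
    set g : ℝ := (G.card : ℝ)
    have hu0 : 0 ≤ u := Nat.cast_nonneg _
    have hg0 : 0 ≤ g := Nat.cast_nonneg _
    -- The probability is `exp (-(u * μ)) * (1 + g * μ)`, and `g` falls short of `u` by at most 4.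
    have hexp : 1 - u * μ ≤ Real.exp (-(u * μ)) := by
      have := Real.add_one_le_exp (-(u * μ)); linarith
    have hgu : u * μ ≤ g * μ + 4 * μ := by nlinarith
    have hgu' : g ≤ u := by exact Nat.cast_le.2 (Finset.card_le_card (Finset.filter_subset _ _))
    have h1 : (1 - u * μ) * (1 + g * μ) ≤ Real.exp (-(u * μ)) * (1 + g * μ) :=
      mul_le_mul_of_nonneg_right hexp (by positivity)
    have h2 : u * μ * (g * μ) ≤ (10 * m * μ) * (10 * m * μ) := by
      have a1 : u * μ ≤ 10 * m * μ := mul_le_mul_of_nonneg_right hu hμ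
      have a2 : g * μ ≤ 10 * m * μ := mul_le_mul_of_nonneg_right (hgu'.trans hu) hμ
      exact mul_le_mul a1 a2 (by positivity) (by positivity)
    nlinarith
  · refine Set.disjoint_left.2 fun ω h1 h2 => ?_
    simp only [mem_iUnion, exists_prop] at h2
    obtain ⟨c, hc, hit⟩ := h2
    have := h1 c (hGz c hc)
    rw [hit.1] at this
    exact one_ne_zero this

/-- By Fubini for the product law, the state can be frozen while the row is averaged. This replaces
conditioning on the past. -/
lemma IndepFun.integral_comp_prodMk {α β : Type*} [MeasurableSpace α] [MeasurableSpace β]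
    {Z : Ω → α} {W : Ω → β} (h : IndepFun Z W P) (hZ : Measurable Z) (hW : Measurable W)
    {g : α × β → ℝ} (hg : Measurable g) (hint : Integrable (fun ω => g (Z ω, W ω)) P) :
    ∫ ω, g (Z ω, W ω) ∂P = ∫ ω, ∫ ω', g (Z ω, W ω') ∂P ∂P := by
  have hlaw := (indepFun_iff_map_prod_eq_prod_map_map hZ.aemeasurable hW.aemeasurable).1 h
  have hpair : Measurable (fun ω => (Z ω, W ω)) := hZ.prodMk hW
  have : IsProbabilityMeasure (P.map Z) := Measure.isProbabilityMeasure_map hZ.aemeasurable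
  have : IsProbabilityMeasure (P.map W) := Measure.isProbabilityMeasure_map hW.aemeasurable
  have hint' : Integrable g ((P.map Z).prod (P.map W)) := by
    rw [← hlaw]
    exact (integrable_map_measure hg.aestronglyMeasurable hpair.aemeasurable).2 hint
  rw [← integral_map (f := g) hpair.aemeasurable hg.aestronglyMeasurable, hlaw,
    integral_prod _ hint', integral_map hZ.aemeasurable
      hint'.aestronglyMeasurable.integral_prod_right']
  refine integral_congr_ae (Filter.Eventually.of_forall fun ω => ?_)
  exact integral_map hW.aemeasurable
    (hg.comp measurable_prodMk_left).aestronglyMeasurable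

open Classical in
lemma IsCellField.integral_apply_step (hN : IsCellField P μ N) (m : ℕ) {K : ℤ} (k : ℕ)
    {z : ℤ × ℤ} (hz : gap z < K) (f : ℤ × ℤ → ℝ) :
    ∫ ω, f (step m K z (row N k ω)) ∂P =
      f z + μ * Real.exp (-((zone m z).card * μ)) * ∑ c ∈ zone m z, (f (move m c z) - f z) := by
  have hmeas : ∀ c, MeasurableSet {ω | IsHit (zone m z) (row N k ω) c} := fun c =>
    hN.measurable_row k (measurableSet_isHit _ c)
  have hterm : ∀ c, (fun ω => if IsHit (zone m z) (row N k ω) c then f (move m c z) - f z else 0)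
      = {ω | IsHit (zone m z) (row N k ω) c}.indicator (fun _ => f (move m c z) - f z) := by
    intro c; ext ω; simp [Set.indicator]
  have hint : ∀ c, Integrable (fun ω => if IsHit (zone m z) (row N k ω) c
      then f (move m c z) - f z else 0) P := by
    intro c
    rw [hterm]
    exact (integrable_const _).indicator (hmeas c)
  simp_rw [apply_step hz]
  rw [integral_add (integrable_const _) (integrable_finsetSum _ fun c _ => hint c),
    integral_finsetSum _ fun c _ => hint c, integral_const, probReal_univ, one_smul,
    Finset.mul_sum]
  congr 1
  refine Finset.sum_congr rfl fun c hc => ?_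
  rw [hterm, integral_indicator_const _ (hmeas c), hN.prob_isHit k hc, smul_eq_mul]

end

section

/-! ### How fast the discrete walks coalesce -/

lemma reachable_fieldChain {Ω : Type*} {N : ℤ × ℕ → Ω → ℕ∞} {m : ℕ} {K : ℤ} (hK : (m : ℤ) ≤ K) (k : ℕ) (ω : Ω) :
    Reachable m K (fieldChain N m K k ω) := reachable_chain hK _ k

lemma Reachable.nonneg_le {m : ℕ} {K : ℤ} (hK : (m : ℤ) ≤ K) {z : ℤ × ℤ} (h : Reachable m K z) :
    (0 : ℝ) ≤ gap z ∧ (gap z : ℝ) ≤ K + m := by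
  have : 0 ≤ gap z ∧ gap z ≤ K + m := by
    unfold Reachable at h; omega
  exact_mod_cast this

/-- Gap zero is absorbing by coalescence and gaps of at least `K` by stopping, so a chain that has
ceased to run never resumes. -/
lemma antitone_running {Ω : Type*} {N : ℤ × ℕ → Ω → ℕ∞} {m : ℕ} (hm : 1 ≤ m) {K : ℤ} (hK : (m : ℤ) ≤ K) :
    Antitone fun k => {ω | m ≤ gap (fieldChain N m K k ω) ∧ gap (fieldChain N m K k ω) < K} := by
  refine antitone_nat_of_succ_le fun k ω hω => ?_
  simp only [mem_ofPred_eq] at hω ⊢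
  set z := fieldChain N m K k ω
  have hstep : fieldChain N m K (k + 1) ω = step m K z (row N k ω) := rfl
  rw [hstep] at hω
  have hlt : gap z < K := by
    by_contra h
    rw [step_of_le (not_lt.1 h)] at hω
    exact h hω.2
  rcases reachable_fieldChain (N := N) hK k ω with h | h
  · rw [gap_step_of_gap_eq_zero h] at hω
    omega
  · exact ⟨h.1, hlt⟩

variable {Ω : Type*} [mΩ : MeasurableSpace Ω] {P : Measure Ω} {μ : ℝ} {N : ℤ × ℕ → Ω → ℕ∞} [IsProbabilityMeasure P]

lemma IsCellField.integrable_apply (hN : IsCellField P μ N) {m : ℕ} {K : ℤ} (hK : (m : ℤ) ≤ K)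
    (k : ℕ) {f : ℤ × ℤ → ℝ} {C : ℝ} (hf : ∀ z, Reachable m K z → |f z| ≤ C) :
    Integrable (fun ω => f (fieldChain N m K k ω)) P := by
  refine Integrable.of_bound (C := C) ?_ (Filter.Eventually.of_forall fun ω => ?_)
  · exact ((measurable_of_countable f).comp (hN.measurable_fieldChain m K k)).aestronglyMeasurable
  · exact hf _ (reachable_fieldChain hK k ω)

lemma IsCellField.integral_succ (hN : IsCellField P μ N) {m : ℕ} {K : ℤ} (hK : (m : ℤ) ≤ K)
    (k : ℕ) {f : ℤ × ℤ → ℝ} {C : ℝ} (hf : ∀ z, Reachable m K z → |f z| ≤ C) :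
    ∫ ω, f (fieldChain N m K (k + 1) ω) ∂P =
      ∫ ω, ∫ ω', f (step m K (fieldChain N m K k ω) (row N k ω')) ∂P ∂P := by
  have hmeas : Measurable (fun p : (ℤ × ℤ) × (ℤ → ℕ∞) => f (step m K p.1 p.2)) :=
    (measurable_of_countable f).comp
      (measurable_from_prod_countable_right fun z => measurable_step m K z)
  exact IndepFun.integral_comp_prodMk (hN.indepFun_fieldChain_row m K k)
    (hN.measurable_fieldChain m K k) (hN.measurable_row k) hmeas
    (hN.integrable_apply hK (k + 1) hf)

lemma IsCellField.integral_gap (hN : IsCellField P μ N) {m : ℕ} {K : ℤ} (hK : (m : ℤ) ≤ K)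
    (k : ℕ) : ∫ ω, (gap (fieldChain N m K k ω) : ℝ) ∂P = 2 * m := by
  induction k with
  | zero => simp [fieldChain, chain, gap]
  | succ k ih =>
    have hb : ∀ z, Reachable m K z → |(gap z : ℝ)| ≤ K + m := fun z hz => by
      have := hz.nonneg_le hK
      rw [abs_of_nonneg this.1]; exact this.2
    rw [hN.integral_succ hK k (f := fun z => (gap z : ℝ)) hb, ← ih]
    congr 1
    ext ω
    set z := fieldChain N m K k ω
    rcases lt_or_ge (gap z) K with h | h
    · rw [hN.integral_apply_step m k h (fun z => (gap z : ℝ))]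
      have := sum_gap_move_sub m z
      have h' : ∑ c ∈ zone m z, ((gap (move m c z) : ℝ) - gap z) = 0 := by exact_mod_cast this
      rw [h', mul_zero, add_zero]
    · simp_rw [step_of_le h]
      simp

/-- By the martingale property the mean increase of the square is the mean squared increment, which
`cube_le_sum_gap_sq` bounds below while the chain runs. -/
lemma IsCellField.integral_gap_sq_succ (hN : IsCellField P μ N) (hμ : 0 ≤ μ) {m : ℕ} (hm : 1 ≤ m)
    {K : ℤ} (hK : (m : ℤ) ≤ K) (k : ℕ) :
    ∫ ω, (gap (fieldChain N m K k ω) : ℝ) ^ 2 ∂P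
      + μ * Real.exp (-(10 * m * μ)) * (m ^ 3 / 3) *
        P.real {ω | m ≤ gap (fieldChain N m K k ω) ∧ gap (fieldChain N m K k ω) < K}
      ≤ ∫ ω, (gap (fieldChain N m K (k + 1) ω) : ℝ) ^ 2 ∂P := by
  have hb : ∀ z, Reachable m K z → |(gap z : ℝ) ^ 2| ≤ (K + m) ^ 2 := fun z hz => by
    have := hz.nonneg_le hK
    rw [abs_of_nonneg (sq_nonneg _)]
    exact pow_le_pow_left₀ this.1 this.2 2
  set v := μ * Real.exp (-(10 * m * μ)) * ((m : ℝ) ^ 3 / 3) with hv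
  have hv0 : 0 ≤ v := by positivity
  set A : Set (ℤ × ℤ) := {z | m ≤ gap z ∧ gap z < K} with hA
  have hAm : MeasurableSet (fieldChain N m K k ⁻¹' A) :=
    hN.measurable_fieldChain m K k (Set.to_countable A).measurableSet
  have hset : {ω | m ≤ gap (fieldChain N m K k ω) ∧ gap (fieldChain N m K k ω) < K}
      = fieldChain N m K k ⁻¹' A := rfl
  have hpoint : ∀ z, (gap z : ℝ) ^ 2 + A.indicator (fun _ => v) z
      ≤ ∫ ω', (gap (step m K z (row N k ω')) : ℝ) ^ 2 ∂P := by
    intro z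
    rcases lt_or_ge (gap z) K with h | h
    · rw [hN.integral_apply_step m k h (fun z => (gap z : ℝ) ^ 2)]
      gcongr
      have hs : (0 : ℝ) ≤ ∑ c ∈ zone m z, ((gap (move m c z) : ℝ) ^ 2 - (gap z : ℝ) ^ 2) := by
        have : 0 ≤ ∑ c ∈ zone m z, (gap (move m c z) ^ 2 - gap z ^ 2) := by
          rw [sum_gap_sq_move_sub]
          exact Finset.sum_nonneg fun _ _ => sq_nonneg _
        exact_mod_cast this
      by_cases hz : z ∈ A
      · rw [indicator_of_mem hz, hv]
        have h3 : (m : ℝ) ^ 3 / 3 ≤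
            ∑ c ∈ zone m z, ((gap (move m c z) : ℝ) ^ 2 - (gap z : ℝ) ^ 2) := by
          rw [div_le_iff₀' (by norm_num)]
          exact_mod_cast cube_le_sum_gap_sq hz.1
        have hu : ((zone m z).card : ℝ) ≤ 10 * m := by exact_mod_cast card_zone_le m hm z
        gcongr
      · rw [indicator_of_notMem hz]
        positivity
    · have hz : z ∉ A := fun hz => absurd hz.2 (not_lt.2 h)
      simp_rw [step_of_le h]
      simp [indicator_of_notMem hz]
  have hi1 := hN.integrable_apply hK k hb
  have hi2 : Integrable ((fieldChain N m K k ⁻¹' A).indicator (fun _ => v)) P :=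
    (integrable_const v).indicator hAm
  rw [hN.integral_succ hK k (f := fun z => (gap z : ℝ) ^ 2) hb, hset]
  have h1 : ∫ ω, (gap (fieldChain N m K k ω) : ℝ) ^ 2 ∂P + v * P.real (fieldChain N m K k ⁻¹' A)
      = ∫ ω, ((gap (fieldChain N m K k ω) : ℝ) ^ 2
        + (fieldChain N m K k ⁻¹' A).indicator (fun _ => v) ω) ∂P := by
    rw [integral_add hi1 hi2, integral_indicator_const _ hAm, smul_eq_mul, mul_comm v]
  rw [h1]
  refine integral_mono (hi1.add hi2) ?_ fun ω => hpoint _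
  refine Integrable.of_bound (C := (K + m) ^ 2) ?_ (Filter.Eventually.of_forall fun ω => ?_)
  · exact ((measurable_of_countable fun z => ∫ ω', (gap (step m K z (row N k ω')) : ℝ) ^ 2 ∂P).comp
      (hN.measurable_fieldChain m K k)).aestronglyMeasurable
  · refine (norm_integral_le_of_norm_le_const (C := (K + m) ^ 2)
      (Filter.Eventually.of_forall fun ω' => ?_)).trans (by simp)
    exact hb _ ((reachable_fieldChain hK k ω).step _)

/-- A chain running at time `n` ran at all earlier times, so each of `n` steps adds at least the
same amount to the second moment. That moment is capped because the gap is at most `K + m` and has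
mean `2 * m`. -/
lemma IsCellField.prob_running_le (hN : IsCellField P μ N) (hμ : 0 ≤ μ) {m : ℕ} (hm : 1 ≤ m)
    {K : ℤ} (hK : (m : ℤ) ≤ K) (n : ℕ) :
    n * (μ * Real.exp (-(10 * m * μ)) * (m ^ 3 / 3)) *
        P.real {ω | m ≤ gap (fieldChain N m K n ω) ∧ gap (fieldChain N m K n ω) < K}
      ≤ (K + m) * (2 * m) := by
  set v := μ * Real.exp (-(10 * m * μ)) * ((m : ℝ) ^ 3 / 3) with hv
  have hv0 : 0 ≤ v := by positivity
  have key : ∀ k ≤ n, k * v *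
      P.real {ω | m ≤ gap (fieldChain N m K n ω) ∧ gap (fieldChain N m K n ω) < K}
      ≤ ∫ ω, (gap (fieldChain N m K k ω) : ℝ) ^ 2 ∂P := by
    intro k hk
    induction k with
    | zero =>
      rw [Nat.cast_zero, zero_mul, zero_mul]
      exact integral_nonneg fun _ => sq_nonneg _
    | succ k ih =>
      have h1 := hN.integral_gap_sq_succ hμ hm hK k
      have h2 := ih (Nat.le_of_succ_le hk)
      have h3 := measureReal_mono (μ := P)
        (antitone_running (N := N) hm hK (Nat.le_of_succ_le hk)) (measure_ne_top _ _)
      have h4 := mul_le_mul_of_nonneg_left h3 hv0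
      push_cast
      rw [add_mul, add_mul, one_mul]
      exact (add_le_add h2 h4).trans h1
  refine (key n le_rfl).trans ?_
  rw [← hN.integral_gap hK n, ← integral_const_mul]
  have hb : ∀ z, Reachable m K z → |(gap z : ℝ) ^ 2| ≤ (K + m) ^ 2 := fun z hz => by
    have := hz.nonneg_le hK
    rw [abs_of_nonneg (sq_nonneg _)]
    exact pow_le_pow_left₀ this.1 this.2 2
  have hb' : ∀ z, Reachable m K z → |((K : ℝ) + m) * gap z| ≤ (K + m) ^ 2 := fun z hz => by
    have := hz.nonneg_le hK
    have h0 : (0 : ℝ) ≤ K + m := this.1.trans this.2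
    rw [abs_of_nonneg (mul_nonneg h0 this.1), sq]
    exact mul_le_mul_of_nonneg_left this.2 h0
  refine integral_mono (hN.integrable_apply hK n hb) (hN.integrable_apply hK n hb') fun ω => ?_
  have := (reachable_fieldChain (N := N) hK n ω).nonneg_le hK
  simp only [sq]
  exact mul_le_mul_of_nonneg_right this.2 this.1

lemma IsCellField.prob_exit_le (hN : IsCellField P μ N) {m : ℕ}
    {K : ℤ} (hK : (m : ℤ) ≤ K) (n : ℕ) :
    K * P.real {ω | K ≤ gap (fieldChain N m K n ω)} ≤ 2 * m := by
  have hb : ∀ z, Reachable m K z → |(gap z : ℝ)| ≤ K + m := fun z hz => by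
    have := hz.nonneg_le hK
    rw [abs_of_nonneg this.1]; exact this.2
  have h := mul_meas_ge_le_integral_of_nonneg
    (Filter.Eventually.of_forall fun ω => ((reachable_fieldChain (N := N) hK n ω).nonneg_le hK).1)
    (hN.integrable_apply hK n hb) (K : ℝ)
  rw [hN.integral_gap hK n] at h
  simpa only [Int.cast_le] using h

/-- The discrete walks have probably met after `n` steps, or come to a distance of at least `K`. -/
lemma IsCellField.prob_gap_ne_zero_le (hN : IsCellField P μ N) (hμ : 0 < μ) {m : ℕ} (hm : 1 ≤ m)
    {K : ℤ} (hK : (m : ℤ) ≤ K) {n : ℕ} (hn : 1 ≤ n) :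
    P.real {ω | gap (fieldChain N m K n ω) ≠ 0} ≤
      2 * m / K + (K + m) * (2 * m) / (n * (μ * Real.exp (-(10 * m * μ)) * (m ^ 3 / 3))) := by
  have hKpos : (0 : ℝ) < K := by exact_mod_cast (by omega : 0 < K)
  have hn' : (0 : ℝ) < n := by exact_mod_cast hn
  have hm' : (0 : ℝ) < m := by exact_mod_cast hm
  have hsub : {ω | gap (fieldChain N m K n ω) ≠ 0} ⊆ {ω | K ≤ gap (fieldChain N m K n ω)} ∪
      {ω | m ≤ gap (fieldChain N m K n ω) ∧ gap (fieldChain N m K n ω) < K} := by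
    intro ω hω
    have := reachable_fieldChain (N := N) hK n ω
    simp only [Reachable, mem_union, mem_ofPred_eq, ne_eq] at *
    omega
  refine (measureReal_mono hsub (measure_ne_top _ _)).trans ((measureReal_union_le _ _).trans ?_)
  refine add_le_add ?_ ?_
  · rw [le_div_iff₀' hKpos]
    exact hN.prob_exit_le hK n
  · rw [le_div_iff₀' (by positivity)]
    exact hN.prob_running_le hμ.le hm hK n

/-- The rows met by the discrete walks are probably all good. -/
lemma IsCellField.prob_not_goodRow_le (hN : IsCellField P μ N) (hμ : 0 ≤ μ) {m : ℕ} (hm : 1 ≤ m)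
    (K : ℤ) (n : ℕ) :
    P.real {ω | ∃ k < n, ¬ GoodRow m (fieldChain N m K k ω) (row N k ω)} ≤
      n * (4 * μ + (10 * m * μ) ^ 2) := by
  have hone : ∀ k, P.real {ω | ¬ GoodRow m (fieldChain N m K k ω) (row N k ω)} ≤
      4 * μ + (10 * m * μ) ^ 2 := by
    intro k
    set B : Set ((ℤ × ℤ) × (ℤ → ℕ∞)) := {p | ¬ GoodRow m p.1 p.2} with hB
    have hBm : MeasurableSet B := by
      have h : Measurable fun p : (ℤ × ℤ) × (ℤ → ℕ∞) => ¬ GoodRow m p.1 p.2 :=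
        measurable_from_prod_countable_right fun z =>
          measurableSet_setOfPred.1 (measurableSet_goodRow m z).compl
      exact measurableSet_setOfPred.2 h
    have hpair : Measurable (fun ω => (fieldChain N m K k ω, row N k ω)) :=
      (hN.measurable_fieldChain m K k).prodMk (hN.measurable_row k)
    have hg : Measurable (B.indicator (fun _ => (1 : ℝ))) := measurable_const.indicator hBm
    have hcomp : (fun ω => B.indicator (fun _ => (1 : ℝ)) (fieldChain N m K k ω, row N k ω))
        = ((fun ω => (fieldChain N m K k ω, row N k ω)) ⁻¹' B).indicator (fun _ => (1 : ℝ)) := rfl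
    have h := IndepFun.integral_comp_prodMk (hN.indepFun_fieldChain_row m K k)
      (hN.measurable_fieldChain m K k) (hN.measurable_row k) hg
      (by rw [hcomp]; exact (integrable_const _).indicator (hpair hBm))
    rw [hcomp, integral_indicator_const _ (hpair hBm), smul_eq_mul, mul_one] at h
    refine (le_of_eq h).trans ?_
    have hin : ∀ ω, ∫ ω', B.indicator (fun _ => (1 : ℝ)) (fieldChain N m K k ω, row N k ω') ∂P
        ≤ 4 * μ + (10 * m * μ) ^ 2 := by
      intro ω
      set z := fieldChain N m K k ω
      have hgm : MeasurableSet {ω' | GoodRow m z (row N k ω')} :=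
        hN.measurable_row k (measurableSet_goodRow m z)
      have he : (fun ω' => B.indicator (fun _ => (1 : ℝ)) (z, row N k ω'))
          = ({ω' | GoodRow m z (row N k ω')}ᶜ).indicator (fun _ => (1 : ℝ)) := rfl
      rw [he, integral_indicator_const _ hgm.compl, smul_eq_mul, mul_one,
        probReal_compl_eq_one_sub hgm]
      have := hN.le_prob_goodRow hμ hm k z
      linarith
    refine (integral_mono_of_nonneg (Filter.Eventually.of_forall fun ω => ?_)
      (integrable_const (4 * μ + (10 * m * μ) ^ 2)) (Filter.Eventually.of_forall hin)).trans
      (by simp)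
    exact integral_nonneg fun ω' => indicator_nonneg (fun _ _ => zero_le_one) _
  have hset : {ω | ∃ k < n, ¬ GoodRow m (fieldChain N m K k ω) (row N k ω)} =
      ⋃ k ∈ Finset.range n, {ω | ¬ GoodRow m (fieldChain N m K k ω) (row N k ω)} := by
    ext ω; simp
  rw [hset]
  refine (measureReal_biUnion_finset_le _ _).trans ((Finset.sum_le_card_nsmul _ _ _
    fun k _ => hone k).trans ?_)
  rw [Finset.card_range, nsmul_eq_mul]

end

section

/-! ### The walks on a configuration of points and the discrete walks -/

/-- The properties of a configuration which make the walks above the horizontal axis well defined;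
a Poisson process has them almost surely. -/
structure IsGeneric (S : Set (ℝ × ℝ)) : Prop where
  ground : ∀ p ∈ S, p.2 ≠ 0
  finite : ∀ L : ℕ, (S ∩ Icc (-L : ℝ) L ×ˢ Icc (0 : ℝ) L).Finite
  height_inj : ∀ p ∈ S, ∀ q ∈ S, 0 ≤ p.2 → p.2 = q.2 → p = q
  above : ∀ (a b : ℚ) (h : ℕ), a < b → ∃ p ∈ S, (a : ℝ) < p.1 ∧ p.1 < b ∧ (h : ℝ) < p.2

/-- The cell of the grid with mesh widths `ε` and `δ` in the column `p.1` and the row `p.2`. -/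
def cell (ε δ : ℝ) (p : ℤ × ℕ) : Set (ℝ × ℝ) :=
  Ico (p.1 * ε) ((p.1 + 1) * ε) ×ˢ Ioc (p.2 * δ) ((p.2 + 1) * δ)

/-- The walk started at `x` has the position `p` at height `h`. -/
structure IsAt (S : Set (ℝ × ℝ)) (r : ℝ) (x : ℝ × ℝ) (h : ℝ) (p : ℝ × ℝ) : Prop where
  reached : ∃ n, ancestor S r x n = p
  mem_or : p ∈ S ∨ p.2 = 0
  nonneg : 0 ≤ p.2
  le : p.2 ≤ h
  lt : ∀ s ∈ S, s ≠ p → |s.1 - p.1| ≤ r → p.2 ≤ s.2 → h < s.2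

variable {S : Set (ℝ × ℝ)} {r : ℝ}

lemma mother_eq {p q : ℝ × ℝ} (hq : q ∈ S) (hw : |q.1 - p.1| ≤ r) (hlt : p.2 < q.2)
    (hmin : ∀ s ∈ S, s ≠ p → |s.1 - p.1| ≤ r → p.2 ≤ s.2 → s ≠ q → q.2 < s.2) :
    mother S r p = q := by
  have hqp : q ≠ p := fun h => by rw [h] at hlt; exact lt_irrefl _ hlt
  have hhit : hitHeight p S r = q.2 := by
    have : {t | p.2 < t ∧ (rect p t r ∩ (S \ {p})).Nonempty} = Ici q.2 := by
      ext t
      simp only [mem_ofPred_eq, mem_Ici]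
      constructor
      · rintro ⟨-, s, ⟨hs1, hs2, hs3⟩, hsS, hsp⟩
        by_cases hsq : s = q
        · rwa [← hsq]
        · exact (hmin s hsS hsp hs1 hs2 hsq).le.trans hs3
      · exact fun ht => ⟨hlt.trans_le ht, q, ⟨hw, hlt.le, ht⟩, hq, hqp⟩
    rw [hitHeight, this, csInf_Ici]
  have hmem : q ∈ rect p (hitHeight p S r) r ∩ (S \ {p}) := by
    rw [hhit]
    exact ⟨⟨hw, hlt.le, le_rfl⟩, hq, hqp⟩
  have huniq : ∀ s, s ∈ rect p (hitHeight p S r) r ∩ (S \ {p}) → s = q := by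
    rw [hhit]
    rintro s ⟨⟨hs1, hs2, hs3⟩, hsS, hsp⟩
    by_contra hsq
    exact absurd hs3 (not_le.2 (hmin s hsS hsp hs1 hs2 hsq))
  have hex : ∃! s, s ∈ rect p (hitHeight p S r) r ∩ (S \ {p}) := ⟨q, hmem, huniq⟩
  rw [mother, dif_pos hex]
  exact huniq _ hex.choose_spec.1

lemma le_mother (p : ℝ × ℝ) : p.2 ≤ (mother S r p).2 := by
  rw [mother]
  split_ifs with h
  · exact h.choose_spec.1.1.2.1
  · exact le_rfl

lemma monotone_ancestor (x : ℝ × ℝ) : Monotone fun n => (ancestor S r x n).2 := by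
  refine monotone_nat_of_le_succ fun n => ?_
  rw [ancestor, ancestor, Function.iterate_succ_apply']
  exact le_mother _

/-- Local finiteness gives a lowest candidate and distinct heights make it unique, so the default
value of `mother` never occurs. -/
lemma IsGeneric.mother_spec (hS : IsGeneric S) (hr : 0 < r) {p : ℝ × ℝ} (hp : p ∈ S ∨ p.2 = 0)
    (h0 : 0 ≤ p.2) :
    mother S r p ∈ S ∧ mother S r p ≠ p ∧ |(mother S r p).1 - p.1| ≤ r := by
  set H := {s ∈ S | s ≠ p ∧ |s.1 - p.1| ≤ r ∧ p.2 ≤ s.2} with hH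
  have hlt : ∀ s ∈ H, p.2 < s.2 := by
    rintro s ⟨hsS, hsp, -, hle⟩
    refine lt_of_le_of_ne hle fun heq => ?_
    rcases hp with hp | hp
    · exact hsp (hS.height_inj p hp s hsS h0 heq).symm
    · exact hS.ground s hsS (heq.symm.trans hp)
  have hne : H.Nonempty := by
    obtain ⟨a, ha1, ha2⟩ := exists_rat_btwn (show p.1 - r < p.1 by linarith)
    obtain ⟨b, hb1, hb2⟩ := exists_rat_btwn (show p.1 < p.1 + r by linarith)
    obtain ⟨h, hh⟩ := exists_nat_ge p.2
    obtain ⟨s, hs, h1, h2, h3⟩ := hS.above a b h (by exact_mod_cast ha2.trans hb1)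
    refine ⟨s, hs, ?_, abs_le.2 ⟨by linarith, by linarith⟩, by linarith⟩
    rintro rfl
    linarith
  obtain ⟨s₀, hs₀⟩ := hne
  obtain ⟨L, hL⟩ := exists_nat_ge (max (|p.1| + r) s₀.2)
  have hfin : (H ∩ {s | s.2 ≤ s₀.2}).Finite := by
    refine (hS.finite L).subset ?_
    rintro s ⟨⟨hsS, -, hsw, hsp⟩, hs⟩
    have h1 := (le_max_left _ _).trans hL
    have h2 : s.2 ≤ L := le_trans hs ((le_max_right _ _).trans hL)
    have h3 : |s.1| ≤ L := by
      have := abs_add_le (s.1 - p.1) p.1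
      rw [sub_add_cancel] at this
      linarith
    exact ⟨hsS, abs_le.1 h3, h0.trans hsp, h2⟩
  obtain ⟨q, ⟨hq, hq₀⟩, hmin⟩ :=
    exists_min_image _ (fun s : ℝ × ℝ => s.2) hfin ⟨s₀, hs₀, le_refl s₀.2⟩
  have hm : mother S r p = q := by
    refine mother_eq hq.1 hq.2.2.1 (hlt q hq) fun s hsS hsp hsw hsh hsq => ?_
    have hsH : s ∈ H := ⟨hsS, hsp, hsw, hsh⟩
    have hle : q.2 ≤ s.2 := by
      rcases le_or_gt s.2 s₀.2 with h | h
      · exact hmin s ⟨hsH, h⟩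
      · exact le_trans hq₀ h.le
    refine lt_of_le_of_ne hle fun heq => hsq ?_
    exact (hS.height_inj q hq.1 s hsS (h0.trans hq.2.2.2) heq).symm
  rw [hm]
  exact ⟨hq.1, hq.2.1, hq.2.2.1⟩

lemma IsAt.walk_eq {x p : ℝ × ℝ} {h : ℝ} (hat : IsAt S r x h p) (hS : IsGeneric S) (hr : 0 < r) :
    walk S r x h = p.1 := by
  obtain ⟨n, hn⟩ := hat.reached
  obtain ⟨h1, h2, h3⟩ := hS.mother_spec hr hat.mem_or hat.nonneg
  have hlt : h < (mother S r p).2 := hat.lt _ h1 h2 h3 (le_mother p)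
  have hsucc : ancestor S r x (n + 1) = mother S r p := by
    rw [← hn, ancestor, ancestor, Function.iterate_succ_apply']
  -- Heights of ancestors are monotone and the next one exceeds `h`, so the infimum in `walk` is
  -- over a single index.
  have hset : {k : ℕ | (ancestor S r x k).2 ≤ h ∧ h < (ancestor S r x (k + 1)).2} = {n} := by
    ext k
    simp only [mem_ofPred_eq, mem_singleton_iff]
    constructor
    · rintro ⟨hk1, hk2⟩
      by_contra hne
      rcases lt_or_gt_of_ne hne with hk | hk
      · have := monotone_ancestor (S := S) (r := r) x (Nat.succ_le_of_lt hk)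
        simp only [Nat.succ_eq_add_one, hn] at this
        linarith [hat.le]
      · have := monotone_ancestor (S := S) (r := r) x (Nat.succ_le_of_lt hk)
        simp only [Nat.succ_eq_add_one, hsucc] at this
        linarith
    · rintro rfl
      rw [hn, hsucc]
      exact ⟨hat.le, hlt⟩
  rw [walk, hset, csInf_singleton, hn]

variable {ε δ : ℝ}

/-- Rows are open below and closed above, to match the strict inequality in `IsAt.lt`. -/
lemma exists_mem_cell (hε : 0 < ε) {s : ℝ × ℝ} {k : ℕ} (h1 : k * δ < s.2)
    (h2 : s.2 ≤ (k + 1) * δ) : ∃ a : ℤ, s ∈ cell ε δ (a, k) := by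
  refine ⟨⌊s.1 / ε⌋, ⟨?_, ?_⟩, h1, h2⟩
  · rw [← le_div_iff₀ hε]; exact Int.floor_le _
  · rw [← div_lt_iff₀ hε]; exact Int.lt_floor_add_one _

lemma abs_col_sub_le (hε : 0 < ε) {m : ℕ} {x y : ℝ} {a b : ℤ}
    (hx : x ∈ Ico (a * ε) ((a + 1) * ε)) (hy : y ∈ Ico (b * ε) ((b + 1) * ε))
    (h : |x - y| ≤ m * ε) : |a - b| ≤ m := by
  rw [abs_le] at h ⊢
  have h1 : (a : ℝ) * ε < (b + 1 + m) * ε := by linarith [hx.1, hy.2, h.2]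
  have h2 : (b : ℝ) * ε < (a + 1 + m) * ε := by linarith [hx.2, hy.1, h.1]
  have h1' := lt_of_mul_lt_mul_right h1 hε.le
  have h2' := lt_of_mul_lt_mul_right h2 hε.le
  norm_cast at h1' h2'
  omega

/-- Compared with `abs_col_sub_le`, only column distance exactly `m` is left undecided; `GoodRow`
excludes hits there. -/
lemma abs_sub_le_of_abs_col_sub_lt (hε : 0 < ε) {m : ℕ} {x y : ℝ} {a b : ℤ}
    (hx : x ∈ Ico (a * ε) ((a + 1) * ε)) (hy : y ∈ Ico (b * ε) ((b + 1) * ε))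
    (h : |a - b| < m) : |x - y| ≤ m * ε := by
  rw [abs_lt] at h
  have h1 : (a : ℝ) + 1 ≤ b + m := by exact_mod_cast (by omega : a + 1 ≤ b + m)
  have h2 : (b : ℝ) + 1 ≤ a + m := by exact_mod_cast (by omega : b + 1 ≤ a + m)
  have h1' := mul_le_mul_of_nonneg_right h1 hε.le
  have h2' := mul_le_mul_of_nonneg_right h2 hε.le
  rw [abs_le]
  constructor <;> linarith [hx.1, hx.2, hy.1, hy.2]

lemma IsAt.of_empty (hε : 0 < ε) (hδ : 0 < δ) {m k : ℕ} {x p : ℝ × ℝ} {i : ℤ}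
    (hat : IsAt S (m * ε) x (k * δ) p) (hp : p.1 ∈ Ico (i * ε) ((i + 1) * ε))
    (hw : ∀ a : ℤ, |a - i| ≤ m → S ∩ cell ε δ (a, k) = ∅) :
    IsAt S (m * ε) x ((k + 1) * δ) p where
  reached := hat.reached
  mem_or := hat.mem_or
  nonneg := hat.nonneg
  le := hat.le.trans (by linarith)
  lt := by
    intro s hs hsp hsw hsh
    by_contra! hle
    obtain ⟨a, ha⟩ := exists_mem_cell hε (hat.lt s hs hsp hsw hsh) hle
    have : s ∈ S ∩ cell ε δ (a, k) := ⟨hs, ha⟩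
    rw [hw a (abs_col_sub_le hε ha.1 hp hsw)] at this
    exact this

/-- After the jump, the window of `q` reaches columns up to `2 * m` away from `i`. These must be
empty as well, lest the walk jump twice within the row. -/
lemma IsAt.of_singleton (hε : 0 < ε) {m k : ℕ} {x p q : ℝ × ℝ} {i c : ℤ}
    (hat : IsAt S (m * ε) x (k * δ) p) (hp : p.1 ∈ Ico (i * ε) ((i + 1) * ε))
    (hc : |c - i| < m) (hq : S ∩ cell ε δ (c, k) = {q})
    (hw : ∀ a : ℤ, |a - i| ≤ 2 * m → a ≠ c → S ∩ cell ε δ (a, k) = ∅) :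
    IsAt S (m * ε) x ((k + 1) * δ) q := by
  obtain ⟨hqS, hqc⟩ : q ∈ S ∩ cell ε δ (c, k) := by rw [hq]; rfl
  have heq : ∀ s ∈ S, ∀ a : ℤ, |a - i| ≤ 2 * m → s ∈ cell ε δ (a, k) → s = q := by
    intro s hs a ha hsa
    by_cases hac : a = c
    · rw [hac] at hsa
      have : s ∈ S ∩ cell ε δ (c, k) := ⟨hs, hsa⟩
      rwa [hq] at this
    · have : s ∈ S ∩ cell ε δ (a, k) := ⟨hs, hsa⟩
      rw [hw a ha hac] at this
      exact absurd this (notMem_empty s)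
  have hpq : p.2 < q.2 := hat.le.trans_lt hqc.2.1
  have hm : mother S (m * ε) p = q := by
    refine mother_eq hqS (abs_sub_le_of_abs_col_sub_lt hε hqc.1 hp hc) hpq
      fun s hs hsp hsw hsh hsq => ?_
    refine lt_of_le_of_lt hqc.2.2 ?_
    by_contra! hle
    obtain ⟨a, ha⟩ := exists_mem_cell hε (hat.lt s hs hsp hsw hsh) hle
    have : |a - i| ≤ m := abs_col_sub_le hε ha.1 hp hsw
    exact hsq (heq s hs a (by omega) ha)
  refine ⟨?_, Or.inl hqS, hat.nonneg.trans hpq.le, hqc.2.2, fun s hs hsq hsw hsh => ?_⟩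
  · obtain ⟨n, hn⟩ := hat.reached
    exact ⟨n + 1, by rw [ancestor, Function.iterate_succ_apply', ← ancestor, hn, hm]⟩
  · by_contra! hle
    obtain ⟨a, ha⟩ := exists_mem_cell hε (hqc.2.1.trans_le hsh) hle
    have := abs_col_sub_le hε ha.1 hqc.1 hsw
    refine hsq (heq s hs a ?_ ha)
    rw [abs_le] at *
    rw [abs_lt] at hc
    omega

/-- At height `h` the walks started at `x` and `y` are in the columns `z.1` and `z.2`; if these
are the same, then the walks have met. -/
def IsCoupled (S : Set (ℝ × ℝ)) (r ε : ℝ) (x y : ℝ × ℝ) (h : ℝ) (z : ℤ × ℤ) : Prop :=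
  ∃ p q, IsAt S r x h p ∧ IsAt S r y h q ∧ p.1 ∈ Ico (z.1 * ε) ((z.1 + 1) * ε) ∧
    q.1 ∈ Ico (z.2 * ε) ((z.2 + 1) * ε) ∧ (z.1 = z.2 → p = q)

lemma IsCoupled.step (hε : 0 < ε) (hδ : 0 < δ) {m k : ℕ} {K : ℤ} {x y : ℝ × ℝ} {z : ℤ × ℤ}
    (h : IsCoupled S (m * ε) ε x y (k * δ) z) (hz : gap z < K)
    (hgood : GoodRow m z (fun a => (S ∩ cell ε δ (a, k)).encard)) :
    IsCoupled S (m * ε) ε x y ((k + 1) * δ)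
      (step m K z (fun a => (S ∩ cell ε δ (a, k)).encard)) := by
  obtain ⟨p, q, hp, hq, hpz, hqz, hpq⟩ := h
  have hz1 : ∀ a : ℤ, |a - z.1| ≤ 2 * m → a ∈ zone m z := by
    intro a ha
    rw [abs_le] at ha
    simp only [zone, Finset.mem_union, Finset.mem_Icc]
    omega
  have hz2 : ∀ a : ℤ, |a - z.2| ≤ 2 * m → a ∈ zone m z := by
    intro a ha
    rw [abs_le] at ha
    simp only [zone, Finset.mem_union, Finset.mem_Icc]
    omega
  rcases hgood with hgood | ⟨c, hc, hc1, hc2, hit⟩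
  · rw [step_of_not_hit fun c hc hit => by
      have := hgood c hc
      rw [hit.1] at this
      exact one_ne_zero this]
    refine ⟨p, q, hp.of_empty hε hδ hpz fun a ha => ?_, hq.of_empty hε hδ hqz fun a ha => ?_,
      hpz, hqz, hpq⟩
    · exact encard_eq_zero.1 (hgood a (hz1 a (by omega)))
    · exact encard_eq_zero.1 (hgood a (hz2 a (by omega)))
  · rw [step_of_hit hz hc hit]
    obtain ⟨s, hs⟩ := encard_eq_one.1 hit.1
    have hsc : s ∈ S ∩ cell ε δ (c, k) := by rw [hs]; rfl
    have hempty : ∀ a ∈ zone m z, a ≠ c → S ∩ cell ε δ (a, k) = ∅ := fun a ha hac =>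
      encard_eq_zero.1 (hit.2 a ha hac)
    have hin : ∀ {w o : ℝ × ℝ} {i : ℤ}, (∀ a : ℤ, |a - i| ≤ 2 * m → a ∈ zone m z) →
        |c - i| ≠ m → IsAt S (m * ε) w (k * δ) o → o.1 ∈ Ico (i * ε) ((i + 1) * ε) →
        IsAt S (m * ε) w ((k + 1) * δ) (if |c - i| ≤ m then s else o) := by
      intro w o i hi hci ho hoi
      split_ifs with hle
      · exact ho.of_singleton hε hoi (lt_of_le_of_ne hle hci) hs
          fun a ha hac => hempty a (hi a ha) hac
      · refine ho.of_empty hε hδ hoi fun a ha => hempty a (hi a (by omega)) ?_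
        rintro rfl
        exact hle ha
    refine ⟨_, _, hin hz1 hc1 hp hpz, hin hz2 hc2 hq hqz, ?_, ?_, ?_⟩
    · simp only [move, jump]
      split_ifs
      · exact hsc.2.1
      · exact hpz
    · simp only [move, jump]
      split_ifs
      · exact hsc.2.1
      · exact hqz
    · simp only [move, jump]
      split_ifs with h1 h2 h2
      · exact fun _ => rfl
      -- A walker jumping alone lands outside the other's window, so the columns cannot agree.
      · rintro rfl; simp at h2
      · intro h; rw [h] at h1; simp at h1
      · exact hpq

lemma isAt_start {x : ℝ × ℝ} (hS : IsGeneric S) (hx : x.2 = 0) : IsAt S r x 0 x where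
  reached := ⟨0, rfl⟩
  mem_or := Or.inr hx
  nonneg := hx.ge
  le := hx.le
  lt s hs _ _ hle := lt_of_le_of_ne (hx ▸ hle) (hS.ground s hs).symm

/-- The stopped chain no longer follows the walks, hence the first alternative; it is harmless when
the final gap is zero. -/
lemma isCoupled_chain (hS : IsGeneric S) (hε : 0 < ε) (hδ : 0 < δ) {m : ℕ} (hm : 1 ≤ m) {K : ℤ}
    {n : ℕ} (hgood : ∀ k < n,
      GoodRow m (chain m K (fun k a => (S ∩ cell ε δ (a, k)).encard) k)
        (fun a => (S ∩ cell ε δ (a, k)).encard)) {k : ℕ} (hk : k ≤ n) :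
    K ≤ gap (chain m K (fun k a => (S ∩ cell ε δ (a, k)).encard) k) ∨
      IsCoupled S (m * ε) ε (0, 0) (2 * (m * ε), 0) (k * δ)
        (chain m K (fun k a => (S ∩ cell ε δ (a, k)).encard) k) := by
  induction k with
  | zero =>
    right
    rw [Nat.cast_zero, zero_mul]
    refine ⟨_, _, isAt_start hS rfl, isAt_start hS rfl, ?_, ?_, ?_⟩
    · simp [chain, hε]
    · simp only [chain, mem_Ico]
      push_cast
      constructor <;> nlinarith
    · simp only [chain]
      omega
  | succ k ih =>
    rcases ih (Nat.le_of_succ_le hk) with h | h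
    · left
      rwa [chain, step_of_le h]
    · rcases lt_or_ge (gap (chain m K (fun k a => (S ∩ cell ε δ (a, k)).encard) k)) K with h' | h'
      · right
        rw [chain]
        push_cast
        exact h.step hε hδ h' (hgood k hk)
      · left
        rwa [chain, step_of_le h']

/-- The walks on a generic configuration have met if the discrete ones have. -/
lemma coalescenceTime_le (hS : IsGeneric S) (hε : 0 < ε) (hδ : 0 < δ) {m : ℕ} (hm : 1 ≤ m) {K : ℤ}
    (hK : 0 < K) {n : ℕ} (hn : 1 ≤ n) (hgood : ∀ k < n,
      GoodRow m (chain m K (fun k a => (S ∩ cell ε δ (a, k)).encard) k)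
        (fun a => (S ∩ cell ε δ (a, k)).encard))
    (hgap : gap (chain m K (fun k a => (S ∩ cell ε δ (a, k)).encard) n) = 0) :
    coalescenceTime S (m * ε) ≤ ((n * δ : ℝ) : EReal) := by
  have hr : 0 < m * ε := by positivity
  rcases isCoupled_chain hS hε hδ hm hgood le_rfl with h | ⟨p, q, hp, hq, -, -, hpq⟩
  · omega
  · refine iInf₂_le (n * δ) ⟨by positivity, ?_⟩
    rw [difference, hp.walk_eq hS hr, hq.walk_eq hS hr, hpq, sub_self]
    rw [gap] at hgap
    omega

end

section

/-! ### Poisson processes -/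

variable {Ω : Type*} [MeasurableSpace Ω] {P : Measure Ω} {lam : ℝ} {S : Ω → Set (ℝ × ℝ)}

lemma IsPoissonProcess.measure_count (hS : IsPoissonProcess P lam S) {B : Set (ℝ × ℝ)}
    (hB : MeasurableSet B) (hvol : volume B < ⊤) (A : Set ℕ∞) :
    P ((fun ω => (S ω ∩ B).encard) ⁻¹' A) =
      poissonMeasure (lam * volume.real B).toNNReal ((Nat.cast : ℕ → ℕ∞) ⁻¹' A) := by
  have hA : MeasurableSet A := (Set.to_countable A).measurableSet
  rw [← Measure.map_apply (hS.measurable_count B hB) hA, hS.law_count B hB hvol,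
    Measure.map_apply (measurable_of_countable _) hA]

lemma IsPoissonProcess.prob_count_eq (hS : IsPoissonProcess P lam S) (hlam : 0 ≤ lam)
    {B : Set (ℝ × ℝ)} (hB : MeasurableSet B) (hvol : volume B < ⊤) (n : ℕ) :
    P.real ((fun ω => (S ω ∩ B).encard) ⁻¹' {(n : ℕ∞)}) =
      Real.exp (-(lam * volume.real B)) * (lam * volume.real B) ^ n / n.factorial := by
  have h : (Nat.cast : ℕ → ℕ∞) ⁻¹' {(n : ℕ∞)} = {n} := by ext; simp
  rw [measureReal_def, hS.measure_count hB hvol, h, ← measureReal_def,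
    poissonMeasure_real_singleton, Real.coe_toNNReal _ (by positivity)]

lemma IsPoissonProcess.ae_finite (hS : IsPoissonProcess P lam S) {B : Set (ℝ × ℝ)}
    (hB : MeasurableSet B) (hvol : volume B < ⊤) : ∀ᵐ ω ∂P, (S ω ∩ B).Finite := by
  have h := hS.measure_count hB hvol {⊤}
  have h' : (Nat.cast : ℕ → ℕ∞) ⁻¹' {⊤} = ∅ := by ext; simp
  rw [h', measure_empty] at h
  have h2 : ∀ᵐ ω ∂P, ¬ (S ω ∩ B).encard = ⊤ := by
    rw [ae_iff]
    simpa [preimage] using h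
  filter_upwards [h2] with ω hω
  exact encard_ne_top_iff.1 hω

variable [IsProbabilityMeasure P]

lemma IsPoissonProcess.prob_two_le_count_le (hS : IsPoissonProcess P lam S) (hlam : 0 ≤ lam)
    {B : Set (ℝ × ℝ)} (hB : MeasurableSet B) (hvol : volume B < ⊤) :
    P.real {ω | 2 ≤ (S ω ∩ B).encard} ≤ (lam * volume.real B) ^ 2 := by
  set ν := lam * volume.real B with hν
  have hν0 : 0 ≤ ν := by positivity
  set X := fun ω => (S ω ∩ B).encard with hX
  have hXm : Measurable X := hS.measurable_count B hB
  have h0 := hS.prob_count_eq hlam hB hvol 0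
  have h1 := hS.prob_count_eq hlam hB hvol 1
  have hm : ∀ n : ℕ, MeasurableSet (X ⁻¹' {(n : ℕ∞)}) := fun n => hXm (measurableSet_singleton _)
  have hset : {ω | 2 ≤ (S ω ∩ B).encard} = (X ⁻¹' {((0 : ℕ) : ℕ∞)} ∪ X ⁻¹' {((1 : ℕ) : ℕ∞)})ᶜ := by
    ext ω
    simp only [hX, mem_ofPred_eq, mem_compl_iff, mem_union, mem_preimage, mem_singleton_iff]
    generalize (S ω ∩ B).encard = e
    induction e with
    | top => simp
    | coe e => norm_cast; omega
  rw [hset, probReal_compl_eq_one_sub ((hm 0).union (hm 1)),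
    measureReal_union (Disjoint.preimage _ (by simp)) (hm 1), h0, h1]
  -- The probability is `1 - exp (-ν) * (1 + ν)`, at most `1 - (1 - ν) * (1 + ν) = ν ^ 2`.
  have hexp : 1 - ν ≤ Real.exp (-ν) := by
    have := Real.add_one_le_exp (-ν); linarith
  simp only [← hν, pow_zero, pow_one, Nat.factorial_zero, Nat.factorial_one, Nat.cast_one, div_one,
    mul_one]
  nlinarith [mul_le_mul_of_nonneg_right hexp (by linarith : 0 ≤ 1 + ν)]

lemma volume_prod_Icc_Ioc {a b c d : ℝ} (hab : a ≤ b) (hcd : c ≤ d) :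
    volume (Icc a b ×ˢ Ioc c d) < ⊤ ∧
      volume.real (Icc a b ×ˢ Ioc c d) = (b - a) * (d - c) := by
  have h : volume (Icc a b ×ˢ Ioc c d) = ENNReal.ofReal ((b - a) * (d - c)) := by
    rw [Measure.volume_eq_prod, Measure.prod_prod, Real.volume_Icc, Real.volume_Ioc,
      ENNReal.ofReal_mul (sub_nonneg.2 hab)]
  refine ⟨by rw [h]; exact ENNReal.ofReal_lt_top, ?_⟩
  rw [measureReal_def, h, ENNReal.toReal_ofReal]
  exact mul_nonneg (sub_nonneg.2 hab) (sub_nonneg.2 hcd)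

lemma volume_cell {ε δ : ℝ} (hε : 0 < ε) (hδ : 0 < δ) (p : ℤ × ℕ) :
    volume (cell ε δ p) < ⊤ ∧ volume.real (cell ε δ p) = ε * δ := by
  have h : volume (cell ε δ p) = ENNReal.ofReal (ε * δ) := by
    rw [cell, Measure.volume_eq_prod, Measure.prod_prod, Real.volume_Ico, Real.volume_Ioc,
      ENNReal.ofReal_mul hε.le]
    congr 2 <;> ring
  refine ⟨by rw [h]; exact ENNReal.ofReal_lt_top, ?_⟩
  rw [measureReal_def, h, ENNReal.toReal_ofReal (by positivity)]

lemma measurableSet_cell (ε δ : ℝ) (p : ℤ × ℕ) : MeasurableSet (cell ε δ p) :=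
  measurableSet_Ico.prod measurableSet_Ioc

lemma disjoint_cell {ε δ : ℝ} (hε : 0 < ε) (hδ : 0 < δ) {p q : ℤ × ℕ} (hpq : p ≠ q) :
    Disjoint (cell ε δ p) (cell ε δ q) := by
  refine Set.disjoint_left.2 fun s ⟨h1, h2⟩ ⟨h3, h4⟩ => hpq ?_
  have a1 : (p.1 : ℝ) < q.1 + 1 := lt_of_mul_lt_mul_right (h1.1.trans_lt h3.2) hε.le
  have a2 : (q.1 : ℝ) < p.1 + 1 := lt_of_mul_lt_mul_right (h3.1.trans_lt h1.2) hε.le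
  have a3 : (p.2 : ℝ) < q.2 + 1 := lt_of_mul_lt_mul_right (h2.1.trans_le h4.2) hδ.le
  have a4 : (q.2 : ℝ) < p.2 + 1 := lt_of_mul_lt_mul_right (h4.1.trans_le h2.2) hδ.le
  norm_cast at a1 a2 a3 a4
  ext
  · omega
  · omega

omit [IsProbabilityMeasure P] in
lemma IsPoissonProcess.isCellField (hS : IsPoissonProcess P lam S) (hlam : 0 ≤ lam) {ε δ : ℝ}
    (hε : 0 < ε) (hδ : 0 < δ) :
    IsCellField P (lam * (ε * δ)) (fun p ω => (S ω ∩ cell ε δ p).encard) where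
  measurable p := hS.measurable_count _ (measurableSet_cell ε δ p)
  indep := by
    refine iIndepFun_iff_finset.2 fun T => ?_
    have h := hS.indep_count T.card (fun i => cell ε δ (T.equivFin.symm i))
      (fun i => measurableSet_cell ε δ _) fun i j hij => disjoint_cell hε hδ fun h =>
        hij (T.equivFin.symm.injective (Subtype.ext h))
    have h' := h.precomp T.equivFin.injective
    simpa [Finset.restrict_def] using h'
  zero p := by
    have h := volume_cell hε hδ p
    have := hS.prob_count_eq hlam (measurableSet_cell ε δ p) h.1 0
    simpa [h.2] using this
  one p := by
    have h := volume_cell hε hδ p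
    have := hS.prob_count_eq hlam (measurableSet_cell ε δ p) h.1 1
    rw [h.2] at this
    simpa [mul_comm] using this

lemma IsPoissonProcess.ae_ground (hS : IsPoissonProcess P lam S) (hlam : 0 ≤ lam) :
    ∀ᵐ ω ∂P, ∀ p ∈ S ω, p.2 ≠ 0 := by
  have hB : MeasurableSet ((univ : Set ℝ) ×ˢ ({0} : Set ℝ)) :=
    MeasurableSet.univ.prod (measurableSet_singleton 0)
  have hvol : volume ((univ : Set ℝ) ×ˢ ({0} : Set ℝ)) = 0 := by
    rw [Measure.volume_eq_prod, Measure.prod_prod, Real.volume_singleton, mul_zero]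
  have h := hS.prob_count_eq hlam hB (by rw [hvol]; exact ENNReal.zero_lt_top) 0
  rw [measureReal_def volume, hvol] at h
  have h2 : ∀ᵐ ω ∂P, ω ∈ (fun ω => (S ω ∩ (univ : Set ℝ) ×ˢ ({0} : Set ℝ)).encard) ⁻¹'
      {((0 : ℕ) : ℕ∞)} := by
    refine (prob_compl_eq_zero_iff (hS.measurable_count _ hB (measurableSet_singleton _))).2 ?_
    rw [← ENNReal.toReal_eq_one_iff, ← measureReal_def, h]
    simp
  filter_upwards [h2] with ω hω p hp h0
  have he : S ω ∩ (univ : Set ℝ) ×ˢ ({0} : Set ℝ) = ∅ := by simpa using hω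
  have : p ∈ S ω ∩ (univ : Set ℝ) ×ˢ ({0} : Set ℝ) := ⟨hp, mem_univ _, h0⟩
  rw [he] at this
  exact this

lemma measure_eq_zero_of_forall_nat {A : Set Ω} {f : ℕ → ℝ}
    (hf : Filter.Tendsto f Filter.atTop (nhds 0)) (h : ∀ n, 1 ≤ n → P.real A ≤ f n) : P A = 0 := by
  rw [← measureReal_eq_zero_iff (measure_ne_top _ _)]
  refine le_antisymm (ge_of_tendsto hf ?_) measureReal_nonneg
  filter_upwards [Filter.eventually_ge_atTop 1] with n hn using h n hn

/-- Cut the box into `n` horizontal slabs. Two points of equal height share a slab, which has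
probability O(1/n²) for each slab and so O(1/n) in total. -/
lemma IsPoissonProcess.ae_height_inj (hS : IsPoissonProcess P lam S) (hlam : 0 ≤ lam) (L : ℕ) :
    ∀ᵐ ω ∂P, ∀ p ∈ S ω ∩ Icc (-L : ℝ) L ×ˢ Ioc (0 : ℝ) L,
      ∀ q ∈ S ω ∩ Icc (-L : ℝ) L ×ˢ Ioc (0 : ℝ) L, p.2 = q.2 → p = q := by
  rw [ae_iff]
  refine measure_eq_zero_of_forall_nat (f := fun n : ℕ => (2 * lam * L ^ 2) ^ 2 / n)
    (tendsto_const_div_atTop_nhds_zero_nat _) fun n hn => ?_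
  have hn' : (0 : ℝ) < n := by exact_mod_cast hn
  set B : ℕ → Set (ℝ × ℝ) := fun j =>
    Icc (-L : ℝ) L ×ˢ Ioc (j * (L / n : ℝ)) ((j + 1) * (L / n : ℝ)) with hBdef
  have hB : ∀ j, MeasurableSet (B j) := fun j => measurableSet_Icc.prod measurableSet_Ioc
  have hvol : ∀ j, volume (B j) < ⊤ ∧ volume.real (B j) = (2 * L) * (L / n) := fun j => by
    have h0 : (0 : ℝ) ≤ L / n := by positivity
    have h := volume_prod_Icc_Ioc (a := -L) (b := L) (c := j * (L / n : ℝ))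
      (d := (j + 1) * (L / n : ℝ)) (by linarith [(Nat.cast_nonneg L : (0 : ℝ) ≤ L)]) (by linarith)
    refine ⟨h.1, h.2.trans (by ring)⟩
  have hsub : {ω | ¬ ∀ p ∈ S ω ∩ Icc (-L : ℝ) L ×ˢ Ioc (0 : ℝ) L,
      ∀ q ∈ S ω ∩ Icc (-L : ℝ) L ×ˢ Ioc (0 : ℝ) L, p.2 = q.2 → p = q} ⊆
      ⋃ j ∈ Finset.range n, {ω | 2 ≤ (S ω ∩ B j).encard} := by
    intro ω hω
    simp only [mem_ofPred_eq] at hω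
    push Not at hω
    obtain ⟨p, ⟨hpS, hp1, hp2, hp3⟩, q, ⟨hqS, hq1, -⟩, heq, hne⟩ := hω
    have hL : (0 : ℝ) < L := hp2.trans_le hp3
    have hLn : (0 : ℝ) < L / n := by positivity
    set x : ℝ := p.2 / (L / n) with hx
    have hx0 : 0 < x := by positivity
    have hxn : x ≤ n := by
      rw [hx, div_le_iff₀ hLn, mul_div_cancel₀ _ hn'.ne']
      exact hp3
    have hc1 : 1 ≤ ⌈x⌉₊ := Nat.one_le_iff_ne_zero.2 (Nat.ceil_pos.2 hx0).ne'
    have hj : ∀ s : ℝ × ℝ, s.1 ∈ Icc (-L : ℝ) L → s.2 = p.2 → s ∈ B (⌈x⌉₊ - 1) := by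
      intro s hs1 hs2
      refine ⟨hs1, ?_⟩
      rw [hs2, mem_Ioc, ← lt_div_iff₀ hLn, ← div_le_iff₀ hLn, ← hx, Nat.cast_sub hc1]
      have h1 := Nat.ceil_lt_add_one hx0.le
      have h2 := Nat.le_ceil x
      push_cast
      constructor <;> linarith
    simp only [mem_iUnion, Finset.mem_range, exists_prop]
    refine ⟨⌈x⌉₊ - 1, ?_, ?_⟩
    · have : ⌈x⌉₊ ≤ n := Nat.ceil_le.2 hxn
      omega
    · rw [mem_ofPred_eq, ← encard_pair hne]
      refine encard_le_encard ?_
      rintro s (rfl | rfl)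
      · exact ⟨hpS, hj s hp1 rfl⟩
      · exact ⟨hqS, hj s hq1 heq.symm⟩
  have hone : ∀ j ∈ Finset.range n, P.real {ω | 2 ≤ (S ω ∩ B j).encard} ≤
      (lam * ((2 * L) * (L / n))) ^ 2 := fun j _ => by
    rw [← (hvol j).2]
    exact hS.prob_two_le_count_le hlam (hB j) (hvol j).1
  refine (measureReal_mono hsub (measure_ne_top _ _)).trans
    ((measureReal_biUnion_finset_le _ _).trans ((Finset.sum_le_card_nsmul _ _ _ hone).trans
      (le_of_eq ?_)))
  rw [Finset.card_range, nsmul_eq_mul]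
  field_simp

lemma IsPoissonProcess.ae_above (hS : IsPoissonProcess P lam S) (hlam : 0 < lam) {a b : ℝ} (h : ℝ)
    (hab : a < b) : ∀ᵐ ω ∂P, ∃ p ∈ S ω, a < p.1 ∧ p.1 < b ∧ h < p.2 := by
  rw [ae_iff]
  obtain ⟨a', ha, ha'⟩ := exists_between hab
  obtain ⟨b', hb, hb'⟩ := exists_between ha'
  have hpos : 0 < lam * (b' - a') := mul_pos hlam (by linarith)
  -- A box of height `n` over the inner interval from `a'` to `b'` is empty with exponentially small
  -- probability.
  refine measure_eq_zero_of_forall_nat (f := fun n : ℕ => Real.exp (-(lam * (b' - a') * n))) ?_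
    fun n _ => ?_
  · exact Real.tendsto_exp_neg_atTop_nhds_zero.comp
      (tendsto_natCast_atTop_atTop.const_mul_atTop hpos)
  · have hv := volume_prod_Icc_Ioc hb.le (show h ≤ h + n by simp)
    have hc := hS.prob_count_eq hlam.le (measurableSet_Icc.prod measurableSet_Ioc) hv.1 0
    rw [hv.2] at hc
    have hc' : P.real ((fun ω => (S ω ∩ Icc a' b' ×ˢ Ioc h (h + n)).encard) ⁻¹' {((0 : ℕ) : ℕ∞)})
        = Real.exp (-(lam * (b' - a') * n)) := by
      rw [hc]; simp [mul_assoc]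
    rw [← hc']
    refine measureReal_mono (fun ω hω => ?_) (measure_ne_top _ _)
    simp only [mem_preimage, mem_singleton_iff, Nat.cast_zero, encard_eq_zero]
    refine eq_empty_of_forall_notMem fun p ⟨hp, hp1, hp2⟩ => hω ⟨p, hp, ?_, ?_, hp2.1⟩
    · exact ha.trans_le hp1.1
    · exact hp1.2.trans_lt hb'

lemma IsPoissonProcess.ae_isGeneric (hS : IsPoissonProcess P lam S) (hlam : 0 < lam) :
    ∀ᵐ ω ∂P, IsGeneric (S ω) := by
  have h1 : ∀ᵐ ω ∂P, ∀ L : ℕ, (S ω ∩ Icc (-L : ℝ) L ×ˢ Icc (0 : ℝ) L).Finite :=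
    ae_all_iff.2 fun L => hS.ae_finite (measurableSet_Icc.prod measurableSet_Icc)
      (isCompact_Icc.prod isCompact_Icc).measure_lt_top
  have h2 := ae_all_iff.2 fun L => hS.ae_height_inj hlam.le L
  have h3 : ∀ᵐ ω ∂P, ∀ (a b : ℚ) (h : ℕ), a < b →
      ∃ p ∈ S ω, (a : ℝ) < p.1 ∧ p.1 < b ∧ (h : ℝ) < p.2 := by
    simp_rw [ae_all_iff]
    exact fun a b h hab => hS.ae_above hlam _ (by exact_mod_cast hab)
  filter_upwards [hS.ae_ground hlam.le, h1, h2, h3] with ω g1 g2 g3 g4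
  refine ⟨g1, g2, fun p hp q hq h0 hpq => ?_, g4⟩
  obtain ⟨L, hL⟩ := exists_nat_ge (max p.2 (max |p.1| |q.1|))
  have hL1 := (le_max_left _ _).trans hL
  have hL2 := (le_max_left _ _).trans ((le_max_right _ _).trans hL)
  have hL3 := (le_max_right _ _).trans ((le_max_right _ _).trans hL)
  have hpos : 0 < p.2 := lt_of_le_of_ne h0 (g1 p hp).symm
  exact g3 L p ⟨hp, abs_le.1 hL2, hpos, hL1⟩ q
    ⟨hq, abs_le.1 hL3, hpq ▸ hpos, hpq ▸ hL1⟩ hpq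

end

section

/-! ### The coalescence time -/

variable {Ω : Type*} [MeasurableSpace Ω] {P : Measure Ω} [IsProbabilityMeasure P] {lam r : ℝ}
  {S : Ω → Set (ℝ × ℝ)}

lemma IsPoissonProcess.prob_coalescenceTime_le_of_grid (hS : IsPoissonProcess P lam S)
    (hlam : 0 < lam) {ε δ : ℝ} (hε : 0 < ε) (hδ : 0 < δ) {m : ℕ} (hm : 1 ≤ m) {K : ℤ}
    (hK : (m : ℤ) ≤ K) {n : ℕ} (hn : 1 ≤ n) :
    P.real {ω | ((n * δ : ℝ) : EReal) < coalescenceTime (S ω) (m * ε)} ≤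
      2 * m / K + (K + m) * (2 * m) / (n * (lam * (ε * δ) *
        Real.exp (-(10 * m * (lam * (ε * δ)))) * (m ^ 3 / 3))) +
      n * (4 * (lam * (ε * δ)) + (10 * m * (lam * (ε * δ))) ^ 2) := by
  have hN := hS.isCellField hlam.le hε hδ
  set N : ℤ × ℕ → Ω → ℕ∞ := fun p ω => (S ω ∩ cell ε δ p).encard with hNdef
  have hμ : 0 < lam * (ε * δ) := by positivity
  have hsub : {ω | ((n * δ : ℝ) : EReal) < coalescenceTime (S ω) (m * ε)} ⊆
      ({ω | gap (fieldChain N m K n ω) ≠ 0} ∪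
        {ω | ∃ k < n, ¬ GoodRow m (fieldChain N m K k ω) (row N k ω)}) ∪
      {ω | ¬ IsGeneric (S ω)} := by
    intro ω hω
    by_contra hcon
    simp only [mem_union, mem_ofPred_eq, not_or, not_not, not_exists, not_and] at hcon
    obtain ⟨⟨hgap, hgood⟩, hgen⟩ := hcon
    exact absurd hω (not_lt.2
      (coalescenceTime_le hgen hε hδ hm (by omega) hn (fun k hk => hgood k hk) hgap))
  have hgen : P.real {ω | ¬ IsGeneric (S ω)} = 0 := by
    rw [measureReal_eq_zero_iff (measure_ne_top _ _)]
    exact ae_iff.1 (hS.ae_isGeneric hlam)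
  refine (measureReal_mono hsub (measure_ne_top _ _)).trans ((measureReal_union_le _ _).trans ?_)
  rw [hgen, add_zero]
  refine (measureReal_union_le _ _).trans (add_le_add ?_ ?_)
  · exact hN.prob_gap_ne_zero_le hμ hm hK hn
  · exact hN.prob_not_goodRow_le hμ.le hm K n

/-- The tail bound for the coalescence time, up to the error of the discretisation. -/
lemma IsPoissonProcess.prob_coalescenceTime_le_add (hS : IsPoissonProcess P lam S)
    (hlam : 0 < lam) (hr : 0 < r) {t : ℝ} (ht : 0 < t) (hrt : r ≤ √t) {m : ℕ} (hm : 1 ≤ m) :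
    P.real {ω | (t : EReal) < coalescenceTime (S ω) r} ≤
      (2 * r + 36 / (lam * r ^ 2)) / √t + (4 * (lam * r * t) + (10 * (lam * r * t)) ^ 2) / m := by
  -- With `n = m * n₀`, the factor 20 keeps the exponent `10 * a / n` below 1/2, and `1 ≤ n₀` gives
  -- `m ≤ n`, so both grid errors are O(1/m).
  obtain ⟨n₀, hn₀⟩ := exists_nat_ge (max 1 (20 * (lam * r * t)))
  have hn₀1 : (1 : ℝ) ≤ n₀ := (le_max_left _ _).trans hn₀
  have hn₀2 : 20 * (lam * r * t) ≤ n₀ := (le_max_right _ _).trans hn₀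
  have hm1 : (1 : ℝ) ≤ m := by exact_mod_cast hm
  have hmpos : (0 : ℝ) < m := by linarith
  have hn₀pos : (0 : ℝ) < n₀ := by linarith
  set n := m * n₀ with hn
  have hncast : (n : ℝ) = m * n₀ := by rw [hn]; push_cast; rfl
  have hnpos : (0 : ℝ) < n := by rw [hncast]; positivity
  have hn1 : 1 ≤ n := by exact_mod_cast hnpos
  set T := √t with hT
  have hTpos : 0 < T := Real.sqrt_pos.2 ht
  have hTT : T * T = t := Real.mul_self_sqrt ht.le
  -- In columns of width `r / m`, this is the distance √t.
  set K := ⌈T * m / r⌉ with hKdef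
  have hK1 : T * m / r ≤ K := Int.le_ceil _
  have hK2 : (K : ℝ) < T * m / r + 1 := Int.ceil_lt_add_one _
  have hmT : (m : ℝ) ≤ T * m / r := by
    rw [le_div_iff₀ hr]; nlinarith
  have hK : (m : ℤ) ≤ K := by exact_mod_cast hmT.trans hK1
  have hKpos : (0 : ℝ) < K := hmpos.trans_le (hmT.trans hK1)
  have h := hS.prob_coalescenceTime_le_of_grid hlam (div_pos hr hmpos) (div_pos ht hnpos) hm hK hn1
  rw [mul_div_cancel₀ t hnpos.ne', mul_div_cancel₀ r hmpos.ne'] at h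
  refine h.trans ?_
  rw [add_div]
  set a := lam * r * t with ha
  have hapos : 0 < a := by positivity
  have hμ : lam * (r / m * (t / n)) = a / (m * n) := by rw [ha]; field_simp
  have hexp : (1 : ℝ) / 2 ≤ Real.exp (-(10 * m * (a / (m * n)))) := by
    have h1 := Real.add_one_le_exp (-(10 * m * (a / (m * n))))
    have h2 : 10 * m * (a / (m * n)) ≤ 1 / 2 := by
      have : 10 * m * (a / (m * n)) = 10 * a / n := by field_simp
      rw [this, div_le_iff₀ hnpos, hncast]
      nlinarith
    linarith
  rw [hμ]
  refine add_le_add (add_le_add ?_ ?_) ?_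
  · rw [div_le_div_iff₀ hKpos hTpos]
    have := mul_le_mul_of_nonneg_left hK1 (by positivity : 0 ≤ 2 * r)
    have h2 : 2 * r * (T * m / r) = 2 * m * T := by field_simp
    linarith
  · have hden : a * m ^ 2 / 6 ≤
        n * (a / (m * n) * Real.exp (-(10 * m * (a / (m * n)))) * (m ^ 3 / 3)) := by
      have h1 : (n : ℝ) * (a / (m * n) * Real.exp (-(10 * m * (a / (m * n)))) * (m ^ 3 / 3)) =
          a * m ^ 2 / 3 * Real.exp (-(10 * m * (a / (m * n)))) := by field_simp
      rw [h1]
      have := mul_le_mul_of_nonneg_left hexp (by positivity : 0 ≤ a * m ^ 2 / 3)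
      linarith
    -- Both 1 and `m` are at most `T * m / r`, since `r ≤ √t`; with the ceiling this gives the
    -- factor 3.
    have hnum : ((K : ℝ) + m) * (2 * m) ≤ (3 * (T * m / r)) * (2 * m) := by
      gcongr
      linarith
    calc ((K : ℝ) + m) * (2 * m) / _ ≤ (3 * (T * m / r)) * (2 * m) / (a * m ^ 2 / 6) := by
          gcongr
      _ = 36 / (lam * r ^ 2) / T := by
          rw [ha, ← hTT]; field_simp; norm_num
  · have h1 : (n : ℝ) * (4 * (a / (m * n)) + (10 * m * (a / (m * n))) ^ 2) =
        4 * a / m + (10 * a) ^ 2 / n := by field_simp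
    rw [h1, add_div]
    have : (m : ℝ) ≤ n := by rw [hncast]; nlinarith
    gcongr

/-- The grid error vanishes as `m` tends to infinity. When `√t < r`, the term `2 * r` alone makes
the bound exceed 1. -/
lemma IsPoissonProcess.prob_coalescenceTime_le (hS : IsPoissonProcess P lam S)
    (hlam : 0 < lam) (hr : 0 < r) {t : ℝ} (ht : 0 < t) :
    P.real {ω | (t : EReal) < coalescenceTime (S ω) r} ≤
      (2 * r + 36 / (lam * r ^ 2)) / √t := by
  have hTpos : 0 < √t := Real.sqrt_pos.2 ht
  rcases le_or_gt r (√t) with hrt | hrt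
  · have hlim := (tendsto_const_div_atTop_nhds_zero_nat
      (4 * (lam * r * t) + (10 * (lam * r * t)) ^ 2)).const_add
        ((2 * r + 36 / (lam * r ^ 2)) / √t)
    rw [add_zero] at hlim
    refine ge_of_tendsto hlim ?_
    filter_upwards [Filter.eventually_ge_atTop 1] with m hm
    exact hS.prob_coalescenceTime_le_add hlam hr ht hrt hm
  · refine measureReal_le_one.trans ?_
    rw [one_le_div hTpos]
    have : 0 < 36 / (lam * r ^ 2) := by positivity
    linarith

end

end PoissonTree

end

theorem lemma2p11 (r lam : ℝ) (hr : 0 < r) (hlam : 0 < lam) :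
    ∃ c : ℝ, 0 < c ∧
      ∀ (Ω : Type*) [MeasurableSpace Ω] (P : Measure Ω) [IsProbabilityMeasure P]
        (S : Ω → Set (ℝ × ℝ)), PoissonTree.IsPoissonProcess P lam S →
        ∀ t : ℝ, 0 < t →
          P {ω | (t : EReal) < PoissonTree.coalescenceTime (S ω) r} ≤
            ENNReal.ofReal (c / √t) := by
  refine ⟨2 * r + 36 / (lam * r ^ 2), by positivity, fun Ω _ P _ S hS t ht => ?_⟩
  rw [← ofReal_measureReal (measure_ne_top _ _)]
  exact ENNReal.ofReal_le_ofReal (hS.prob_coalescenceTime_le hlam hr ht)
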